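/- Notation. For $g\in L^2(\mathbb R)$ put $\langle x\rangle=(1+|x|^2)^{1/2}$, $\|g\|_{H^{1,0}}=\|\langle\nabla\rangle g\|_{L^2}$, $\|g\|_{H^{0,1}}=\|\langle x\rangle g\|_{L^2}$, $\|g\|_{\dot H^{1,0}}=\|\,|\nabla| g\|_{L^2}$, $\|g\|_{\dot H^{0,1}}=\|\,|x|g\|_{L^2}$, where $\langle\nabla\rangle$, $|\nabla|$ and $e^{it\partial_{xx}/2}$ are the Fourier multipliers with symbols $\langle\xi\rangle$, $|\xi|$ and $e^{-it\xi^2/2}$. For $T>1$ and $u_\ast\in H^{1,0}\cap H^{0,1}$, a solution on $[1,T]$ of the one-dimensional cubic NLS $$ i\partial_t u+\tfrac12\partial_{xx}u=|u|^2u,\qquad u|_{t=1}=e^{i\partial_{xx}/2}u_\ast, $$ is a function $u\in C([1,T];H^{1,0}(\mathbb R)\cap H^{0,1}(\mathbb R))$ with $$u(t)=e^{it\partial_{xx}/2}u_\ast-i\int_1^te^{i(t-s)\partial_{xx}/2}|u(s)|^2u(s)\,ds\qquad(1\le t\le T).$$ Its profile is $f(t)=e^{-it\partial_{xx}/2}u(t)$.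 For $\alpha>0$ put, with $L^\infty_T:=L^\infty_t([1,T])$, $$\|u\|_{X_T}=\|t^{1/2}u\|_{L^\infty_TL^\infty_x}+\|t^{-\alpha}u\|_{L^\infty_T\dot H^{1,0}_x}+\|t^{-\alpha}f\|_{L^\infty_T\dot H^{0,1}_x}+\|u\|_{L^\infty_TL^2_x}.$$ Proposition 1.3. There are an absolute constant $C_0\ge 0$ and an $\alpha_0>0$ such that for every $0<\alpha<\alpha_0$ there is a constant $C\ge 0$, depending only on $\alpha$, with the following property. For all $\varepsilon\ge0$, all $T>1$, all $u_\ast$ with $\|u_\ast\|_{H^{1,0}}+\|u_\ast\|_{H^{0,1}}\le\varepsilon$ and every solution $u$ on $[1,T]$ as above, one has $\|u\|_{X_T}<\infty$ and $$\|u\|_{X_T}\le C_0\,\varepsilon+C\,\|u\|_{X_T}^3 .$$ In particular $C_0$ and $C$ are independent of $T$, $\varepsilon$, $u_\ast$ and $u$. -/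

import Mathlib

open MeasureTheory Set Filter Topology
open scoped ENNReal NNReal FourierTransform

noncomputable section

namespace NLS

/-- Complex-valued square integrable functions on the real line. -/
abbrev L2 : Type := Lp ℂ 2 (volume : Measure ℝ)

/-- The symbol of the free Schroedinger group `exp (i t ∂ₓₓ / 2)`, as a function of the variable `k`
of Mathlib's Fourier transform `∫ exp (-2πi x k) g x dx`: the frequency is `ξ = 2πk` and the symbol
is `exp (-i t ξ² / 2)`. -/
def schrodingerSymbol (t k : ℝ) : ℂ :=
  Complex.exp (-Complex.I * ((t * (2 * Real.pi * k) ^ 2 / 2 : ℝ) : ℂ))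

theorem norm_schrodingerSymbol (t k : ℝ) : ‖schrodingerSymbol t k‖ = 1 := by
  rw [schrodingerSymbol, Complex.norm_exp]
  simp [-Complex.ofReal_div, -Complex.ofReal_mul, -Complex.ofReal_pow]

theorem continuous_schrodingerSymbol (t : ℝ) : Continuous (schrodingerSymbol t) := by
  unfold schrodingerSymbol
  fun_prop

theorem memLp_schrodingerSymbol_mul (t : ℝ) (g : L2) :
    MemLp (fun k => schrodingerSymbol t k * g k) 2 volume := by
  refine (Lp.memLp g).congr_norm ?_ (Eventually.of_forall fun k => ?_)
  · exact (continuous_schrodingerSymbol t).aestronglyMeasurable.mul (Lp.aestronglyMeasurable g)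
  · simp [norm_schrodingerSymbol]

/-- The free Schroedinger group `exp (i t ∂ₓₓ / 2)` on `L²(ℝ)`, as a Fourier multiplier. -/
def freeGroup (t : ℝ) (g : L2) : L2 :=
  𝓕⁻ ((memLp_schrodingerSymbol_mul t (𝓕 g)).toLp _)

/-- The norm `‖⟨∇⟩ g‖_{L²}` of `H^{1,0}`. -/
def normH10 (g : L2) : ℝ≥0∞ :=
  eLpNorm (fun k : ℝ => Real.sqrt (1 + (2 * Real.pi * k) ^ 2) • (𝓕 g : L2) k) 2 volume

/-- The norm `‖⟨x⟩ g‖_{L²}` of `H^{0,1}`. -/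
def normH01 (g : L2) : ℝ≥0∞ :=
  eLpNorm (fun x : ℝ => Real.sqrt (1 + x ^ 2) • g x) 2 volume

/-- The homogeneous norm `‖|∇| g‖_{L²}`. -/
def normHdot10 (g : L2) : ℝ≥0∞ :=
  eLpNorm (fun k : ℝ => |2 * Real.pi * k| • (𝓕 g : L2) k) 2 volume

/-- The homogeneous norm `‖|x| g‖_{L²}`. -/
def normHdot01 (g : L2) : ℝ≥0∞ :=
  eLpNorm (fun x : ℝ => |x| • g x) 2 volume

open Classical in
/-- The cubic nonlinearity `|v|² v` as an element of `L²(ℝ)`. It is used for `v` in `H¹(ℝ)`,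
which is contained in `L²(ℝ) ∩ L^∞(ℝ)`, so that `|v|² v` does lie in `L²(ℝ)`. -/
def cubic (v : L2) : L2 :=
  if h : MemLp (fun x => ‖v x‖ ^ 2 • v x) 2 volume then h.toLp _ else 0

/-- `u ∈ C([1, T]; H^{1,0} ∩ H^{0,1})`. -/
def ContinuousIntoH (T : ℝ) (u : ℝ → L2) : Prop :=
  (∀ t ∈ Icc 1 T, normH10 (u t) < ∞ ∧ normH01 (u t) < ∞) ∧
  ∀ t₀ ∈ Icc 1 T,
    Tendsto (fun t => normH10 (u t - u t₀) + normH01 (u t - u t₀)) (𝓝[Icc 1 T] t₀) (𝓝 0)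

/-- `u ∈ C([1, T]; H^{1,0} ∩ H^{0,1})` solves `i ∂ₜ u + ½ ∂ₓₓ u = |u|² u` on `[1, T]` with
`u(1) = exp (i ∂ₓₓ / 2) u⋆`, in the sense of the integral (Duhamel) equation
`u(t) = exp (i t ∂ₓₓ / 2) u⋆ - i ∫₁ᵗ exp (i (t - s) ∂ₓₓ / 2) (|u(s)|² u(s)) ds` in `L²(ℝ)`. -/
structure IsSolution (T : ℝ) (uStar : L2) (u : ℝ → L2) : Prop where
  continuous : ContinuousIntoH T u
  duhamel : ∀ t ∈ Icc 1 T,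
    u t = freeGroup t uStar
      - Complex.I • ∫ s in (1 : ℝ)..t, freeGroup (t - s) (cubic (u s))

/-- The profile `f(t) = exp (-i t ∂ₓₓ / 2) u(t)`. -/
def profile (u : ℝ → L2) (t : ℝ) : L2 := freeGroup (-t) (u t)

/-- The `L^∞` norm in time over `[1, T]`. -/
def supTime (T : ℝ) (φ : ℝ → ℝ≥0∞) : ℝ≥0∞ :=
  essSup φ (volume.restrict (Icc 1 T))

/-- The norm of `X_T`. -/
def normX (α T : ℝ) (u : ℝ → L2) : ℝ≥0∞ :=
  supTime T (fun t => ENNReal.ofReal (t ^ (1 / 2 : ℝ)) * eLpNorm (u t) ∞ volume)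
  + supTime T (fun t => ENNReal.ofReal (t ^ (-α)) * normHdot10 (u t))
  + supTime T (fun t => ENNReal.ofReal (t ^ (-α)) * normHdot01 (profile u t))
  + supTime T (fun t => eLpNorm (u t) 2 volume)

end NLS

end

noncomputable section

namespace NLS

/-!
Write `U(t)` for the free group and `f(t) = U(-t) u(t)` for the profile, so that
`f(t) = u⋆ - i ∫₁ᵗ U(-s) (|u|² u)(s) ds`. Everything rests on the factorisation of `U(s)` as chirp,
Fourier transform, dilation to the scale `2πs`, chirp, in which `u(s)` becomes `w(s)`, the Fourier
transform of a chirp times `f(s)`.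

Multiplication by a chirp turns `‖x f(s)‖` into the norm of a derivative of a function of modulus
`|u(s)|`. Hence both growing norms of the integrand are at most `3 ‖u(s)‖_∞²` times those of `u(s)`,
that is `O(s^(α - 1))`, which integrates to `O(t^α)`. The mass is conserved because the cubic term
is a real multiple of `u`.

For the dispersive decay, the same factorisation turns the integrand into `|w|² w / (2πs)`, which is
again a real multiple of `w` and only rotates its phase. Discarding the chirp (or cutting `f` off at
`x² ≤ t`) changes a Fourier transform by `O(s^(-1/4) ‖x f(s)‖)`, so the modulus of the Fourier
transform of `f` moves at the rate `O(s^(α - 5/4))`, integrable for `α < 1/4`. Its bound is a bound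
for `w(t)`, that is for `t^(1/2) u(t)`.
-/

section FourierIntegral

variable {V F : Type*} [NormedAddCommGroup V] [InnerProductSpace ℝ V] [FiniteDimensional ℝ V]
  [MeasurableSpace V] [BorelSpace V]

theorem ae_eq_of_integral_schwartz_smul_eq [NormedAddCommGroup F] [NormedSpace ℂ F]
    [CompleteSpace F] {f g : V → F} (hf : LocallyIntegrable f) (hg : LocallyIntegrable g)
    (h : ∀ φ : SchwartzMap V ℂ, ∫ x, φ x • f x = ∫ x, φ x • g x) : f =ᵐ[volume] g := by
  refine ae_eq_of_integral_contDiff_smul_eq hf hg fun φ hφ hc => ?_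
  have hc' : HasCompactSupport (Complex.ofRealCLM ∘ φ) := hc.comp_left rfl
  simpa using h (hc'.toSchwartzMap (Complex.ofRealCLM.contDiff.comp hφ))

theorem continuous_fourier [NormedAddCommGroup F] [NormedSpace ℂ F] {f : V → F}
    (hf : Integrable f) : Continuous (𝓕 f) :=
  VectorFourier.fourierIntegral_continuous Real.continuous_fourierChar
    (by exact continuous_inner) hf

theorem norm_fourier_le [NormedAddCommGroup F] [NormedSpace ℂ F] (f : V → F) (k : V) :
    ‖𝓕 f k‖ ≤ ∫ x, ‖f x‖ :=
  VectorFourier.norm_fourierIntegral_le_integral_norm _ _ _ f k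

theorem enorm_fourier_le [NormedAddCommGroup F] [NormedSpace ℂ F] (f : V → F) (k : V) :
    ‖𝓕 f k‖ₑ ≤ eLpNorm f 1 volume := by
  rw [eLpNorm_one_eq_lintegral_enorm, Real.fourier_eq]
  refine (enorm_integral_le_lintegral_enorm _).trans_eq (lintegral_congr fun x => ?_)
  rw [← ofReal_norm, Circle.norm_smul, ofReal_norm]

theorem fourier_sub_apply [NormedAddCommGroup F] [NormedSpace ℂ F] {f g : V → F}
    (hf : Integrable f) (hg : Integrable g) (k : V) :
    𝓕 (fun x => f x - g x) k = 𝓕 f k - 𝓕 g k := by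
  simp only [Real.fourier_eq, smul_sub]
  exact integral_sub ((Real.fourierIntegral_convergent_iff k).2 hf)
    ((Real.fourierIntegral_convergent_iff k).2 hg)

theorem integral_fourier_smul_eq [NormedAddCommGroup F] [NormedSpace ℂ F] [CompleteSpace F]
    {f : V → ℂ} {g : V → F} (hf : Integrable f) (hg : Integrable g) :
    ∫ k, 𝓕 f k • g k = ∫ x, f x • 𝓕 g x := by
  simpa using! VectorFourier.integral_fourierIntegral_smul_eq_flip (μ := volume) (ν := volume)
    (L := innerₗ V) Real.continuous_fourierChar continuous_inner hf hg

variable [NormedAddCommGroup F] [InnerProductSpace ℂ F] [CompleteSpace F]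

theorem fourier_coeFn_ae_eq {f : Lp F 2 (volume : Measure V)} (hf : Integrable f) :
    (𝓕 f : Lp F 2 (volume : Measure V)) =ᵐ[volume] 𝓕 (f : V → F) := by
  refine ae_eq_of_integral_schwartz_smul_eq ((Lp.memLp _).locallyIntegrable one_le_two)
    (continuous_fourier hf).locallyIntegrable fun φ => ?_
  have h := DFunLike.congr_fun (Lp.fourier_toTemperedDistribution_eq f) φ
  simp only [TemperedDistribution.fourier_apply, Lp.toTemperedDistribution_apply,
    SchwartzMap.fourier_coe] at h
  rw [← integral_fourier_smul_eq φ.integrable hf, h]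

theorem fourierInv_coeFn_ae_eq {f : Lp F 2 (volume : Measure V)} (hf : Integrable f) :
    (𝓕⁻ f : Lp F 2 (volume : Measure V)) =ᵐ[volume] 𝓕⁻ (f : V → F) := by
  rw [Real.fourierInv_eq_fourier_comp_neg]
  refine ae_eq_of_integral_schwartz_smul_eq ((Lp.memLp _).locallyIntegrable one_le_two)
    (continuous_fourier hf.comp_neg).locallyIntegrable fun φ => ?_
  have h := DFunLike.congr_fun (Lp.fourierInv_toTemperedDistribution_eq f) φ
  simp only [TemperedDistribution.fourierInv_apply, Lp.toTemperedDistribution_apply,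
    SchwartzMap.fourierInv_coe, Real.fourierInv_eq_fourier_neg] at h
  rw [← integral_fourier_smul_eq φ.integrable hf.comp_neg, ← h, ← integral_neg_eq_self]
  simp only [neg_neg]

theorem fourier_toLp_ae_eq {f : V → F} (hf : Integrable f) (hf2 : MemLp f 2 volume) :
    (𝓕 (hf2.toLp f) : Lp F 2 (volume : Measure V)) =ᵐ[volume] 𝓕 f := by
  filter_upwards [fourier_coeFn_ae_eq ((integrable_congr hf2.coeFn_toLp).2 hf)] with k hk
  rw [hk, Real.fourier_congr_ae hf2.coeFn_toLp]

theorem eLpNorm_fourier {f : V → F} (hf : Integrable f) (hf2 : MemLp f 2 volume) :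
    eLpNorm (𝓕 f) 2 volume = eLpNorm f 2 volume := by
  rw [← eLpNorm_congr_ae (fourier_toLp_ae_eq hf hf2), ← eLpNorm_congr_ae hf2.coeFn_toLp,
    ← Lp.enorm_def, ← Lp.enorm_def, ← ofReal_norm, ← ofReal_norm, Lp.norm_fourier_eq]

end FourierIntegral

section Multiplier

variable {X : Type*} [MeasurableSpace X] {μ : Measure X}

theorem eLpNorm_two_eq_lintegral {E : Type*} [NormedAddCommGroup E] (f : X → E) :
    eLpNorm f 2 μ = (∫⁻ x, ‖f x‖ₑ ^ 2 ∂μ) ^ (1 / 2 : ℝ) := by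
  simp [eLpNorm_eq_lintegral_rpow_enorm_toReal two_ne_zero ENNReal.ofNat_ne_top]

theorem lintegral_enorm_sq_lt_top {E : Type*} [NormedAddCommGroup E] {f : X → E}
    (hf : MemLp f 2 μ) : ∫⁻ x, ‖f x‖ₑ ^ 2 ∂μ < ∞ := by
  simpa using lintegral_rpow_enorm_lt_top_of_eLpNorm_lt_top two_ne_zero ENNReal.ofNat_ne_top hf.2

theorem tendsto_eLpNorm_two_of_dominated {E : Type*} [NormedAddCommGroup E] {ι : Type*}
    {l : Filter ι} [l.IsCountablyGenerated] {f : ι → X → E} {g : X → ℝ} (hg : MemLp g 2 μ)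
    (hf : ∀ i, AEStronglyMeasurable (f i) μ) (hfg : ∀ i x, ‖f i x‖ ≤ g x)
    (hlim : ∀ x, Tendsto (fun i => f i x) l (𝓝 0)) :
    Tendsto (fun i => eLpNorm (f i) 2 μ) l (𝓝 0) := by
  have h : Tendsto (fun i => ∫⁻ x, ‖f i x‖ₑ ^ 2 ∂μ) l (𝓝 (∫⁻ _, 0 ∂μ)) := by
    refine tendsto_lintegral_filter_of_dominated_convergence' (fun x => ‖g x‖ₑ ^ 2)
      (Eventually.of_forall fun i => (hf i).enorm.pow_const 2)
      (Eventually.of_forall fun i => Eventually.of_forall fun x => ?_)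
      (lintegral_enorm_sq_lt_top hg).ne (Eventually.of_forall fun x => ?_)
    · gcongr
      exact enorm_le_iff_norm_le.2 ((hfg i x).trans (le_abs_self _))
    · simpa using ENNReal.Tendsto.pow (n := 2) (hlim x).enorm
  simp only [eLpNorm_two_eq_lintegral]
  simpa using h.ennrpow_const (1 / 2 : ℝ)

theorem tendsto_eLpNorm_mul_sub {ι : Type*} {l : Filter ι} [l.IsCountablyGenerated]
    {m : ι → X → ℂ} {m₀ g : X → ℂ} (hg : MemLp g 2 μ)
    (hm : ∀ i, AEStronglyMeasurable (m i) μ) (hm₀ : AEStronglyMeasurable m₀ μ)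
    (hb : ∀ i x, ‖m i x‖ ≤ 1) (hb₀ : ∀ x, ‖m₀ x‖ ≤ 1)
    (hlim : ∀ x, Tendsto (fun i => m i x) l (𝓝 (m₀ x))) :
    Tendsto (fun i => eLpNorm (fun x => m i x * g x - m₀ x * g x) 2 μ) l (𝓝 0) := by
  refine tendsto_eLpNorm_two_of_dominated (hg.norm.const_mul 2)
    (fun i => ((hm i).mul hg.1).sub (hm₀.mul hg.1)) (fun i x => ?_) fun x => ?_
  · rw [← sub_mul, norm_mul]
    gcongr
    exact (norm_sub_le _ _).trans (by linarith [hb i x, hb₀ x])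
  · simpa using ((hlim x).mul_const (g x)).sub_const (m₀ x * g x)

/-- Multiplication by a bounded function `m`, as an operator on `L²`. -/
def mulL2 (m : X → ℂ) (hm : MemLp m ∞ μ) : Lp ℂ 2 μ →L[ℂ] Lp ℂ 2 μ :=
  (ContinuousLinearMap.mul ℂ ℂ).holderL μ ∞ 2 2 (hm.toLp m)

theorem mulL2_ae_eq {m : X → ℂ} (hm : MemLp m ∞ μ) (g : Lp ℂ 2 μ) :
    mulL2 m hm g =ᵐ[μ] fun x => m x * g x := by
  filter_upwards [(ContinuousLinearMap.mul ℂ ℂ).coeFn_holder (r := 2) (hm.toLp m) g,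
    hm.coeFn_toLp] with x h1 h2
  exact h1.trans (by rw [h2]; rfl)

theorem tendsto_mulL2 {ι : Type*} {l : Filter ι} [l.IsCountablyGenerated]
    {m : ι → X → ℂ} {m₀ : X → ℂ} (hm : ∀ i, MemLp (m i) ∞ μ)
    (hm₀ : MemLp m₀ ∞ μ) (hb : ∀ i x, ‖m i x‖ ≤ 1) (hb₀ : ∀ x, ‖m₀ x‖ ≤ 1)
    (hlim : ∀ x, Tendsto (fun i => m i x) l (𝓝 (m₀ x))) (g : Lp ℂ 2 μ) :
    Tendsto (fun i => mulL2 (m i) (hm i) g) l (𝓝 (mulL2 m₀ hm₀ g)) := by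
  rw [Lp.tendsto_Lp_iff_tendsto_eLpNorm']
  refine (tendsto_eLpNorm_mul_sub (Lp.memLp g) (fun i => (hm i).1) hm₀.1 hb hb₀ hlim).congr
    fun i => eLpNorm_congr_ae ?_
  filter_upwards [mulL2_ae_eq (hm i) g, mulL2_ae_eq hm₀ g] with x h1 h2
  rw [Pi.sub_apply, h1, h2]

end Multiplier

section FreeGroup

theorem memLp_schrodingerSymbol (t : ℝ) : MemLp (schrodingerSymbol t) ∞ volume :=
  memLp_top_of_bound (continuous_schrodingerSymbol t).aestronglyMeasurable 1
    (Eventually.of_forall fun k => (norm_schrodingerSymbol t k).le)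

theorem freeGroup_eq_fourierInv_mulL2 (t : ℝ) (g : L2) :
    freeGroup t g = 𝓕⁻ (mulL2 (schrodingerSymbol t) (memLp_schrodingerSymbol t) (𝓕 g)) := by
  refine congrArg (fun h : L2 => (𝓕⁻ h : L2)) (Lp.ext ?_)
  filter_upwards [(memLp_schrodingerSymbol_mul t (𝓕 g)).coeFn_toLp,
    mulL2_ae_eq (memLp_schrodingerSymbol t) (𝓕 g)] with k h1 h2
  rw [h1, h2]

theorem fourier_freeGroup_ae_eq (t : ℝ) (g : L2) :
    (𝓕 (freeGroup t g) : L2) =ᵐ[volume] fun k => schrodingerSymbol t k * (𝓕 g : L2) k := by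
  rw [freeGroup, FourierTransform.fourier_fourierInv_eq]
  exact (memLp_schrodingerSymbol_mul t (𝓕 g)).coeFn_toLp

theorem norm_freeGroup (t : ℝ) (g : L2) : ‖freeGroup t g‖ = ‖g‖ := by
  rw [← Lp.norm_fourier_eq (freeGroup t g), ← Lp.norm_fourier_eq g, Lp.norm_def, Lp.norm_def]
  congr 1
  refine eLpNorm_congr_norm_ae ?_
  filter_upwards [fourier_freeGroup_ae_eq t g] with k hk
  rw [hk, norm_mul, norm_schrodingerSymbol, one_mul]

theorem normHdot10_freeGroup (t : ℝ) (g : L2) : normHdot10 (freeGroup t g) = normHdot10 g := by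
  refine eLpNorm_congr_norm_ae ?_
  filter_upwards [fourier_freeGroup_ae_eq t g] with k hk
  rw [hk, norm_smul, norm_smul, norm_mul, norm_schrodingerSymbol, one_mul]

/-- The free Schroedinger group as a linear isometry of `L²`. -/
def freeGroupIsometry (t : ℝ) : L2 →ₗᵢ[ℂ] L2 where
  toFun := freeGroup t
  map_add' f g := by
    simp only [freeGroup_eq_fourierInv_mulL2, FourierTransform.fourier_add, map_add,
      FourierTransform.fourierInv_add]
  map_smul' c g := by
    simp only [freeGroup_eq_fourierInv_mulL2, FourierTransform.fourier_smul, map_smul,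
      FourierTransform.fourierInv_smul, RingHom.id_apply]
  norm_map' := norm_freeGroup t

@[simp]
theorem freeGroupIsometry_apply (t : ℝ) (g : L2) : freeGroupIsometry t g = freeGroup t g := rfl

theorem freeGroup_sub (t : ℝ) (f g : L2) : freeGroup t (f - g) = freeGroup t f - freeGroup t g :=
  map_sub (freeGroupIsometry t) f g

theorem L2_ext_fourier {f g : L2} (h : (𝓕 f : L2) =ᵐ[volume] (𝓕 g : L2)) : f = g :=
  (Lp.fourierTransformₗᵢ ℝ ℂ).injective (Lp.ext h)

theorem freeGroup_freeGroup (s t : ℝ) (g : L2) :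
    freeGroup s (freeGroup t g) = freeGroup (s + t) g := by
  apply L2_ext_fourier
  filter_upwards [fourier_freeGroup_ae_eq s (freeGroup t g), fourier_freeGroup_ae_eq t g,
    fourier_freeGroup_ae_eq (s + t) g] with k h1 h2 h3
  rw [h1, h2, h3, ← mul_assoc, schrodingerSymbol, schrodingerSymbol, schrodingerSymbol,
    ← Complex.exp_add]
  congr 2
  push_cast
  ring

theorem freeGroup_zero (g : L2) : freeGroup 0 g = g := by
  apply L2_ext_fourier
  filter_upwards [fourier_freeGroup_ae_eq 0 g] with k hk
  simp [hk, schrodingerSymbol]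

theorem continuous_fourierInv_L2 : Continuous fun g : L2 => (𝓕⁻ g : L2) :=
  (Lp.fourierTransformₗᵢ ℝ ℂ).symm.continuous

theorem continuous_freeGroup (g : L2) : Continuous fun t => freeGroup t g := by
  simp only [freeGroup_eq_fourierInv_mulL2]
  refine continuous_fourierInv_L2.comp (continuous_iff_continuousAt.2 fun t₀ => ?_)
  refine tendsto_mulL2 memLp_schrodingerSymbol (memLp_schrodingerSymbol t₀)
    (fun t k => (norm_schrodingerSymbol t k).le) (fun k => (norm_schrodingerSymbol t₀ k).le)
    (fun k => ?_) (𝓕 g)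
  have h : Continuous fun t => schrodingerSymbol t k := by unfold schrodingerSymbol; fun_prop
  exact h.tendsto t₀

theorem continuousOn_freeGroup_comp {Y : Type*} [TopologicalSpace Y] {S : Set Y} {θ : Y → ℝ}
    (hθ : ContinuousOn θ S) {G : Y → L2} (hG : ContinuousOn G S) :
    ContinuousOn (fun s => freeGroup (θ s) (G s)) S := by
  intro s₀ hs₀
  have hTime : Tendsto (fun s => freeGroup (θ s) (G s₀)) (𝓝[S] s₀)
      (𝓝 (freeGroup (θ s₀) (G s₀))) :=
    ((continuous_freeGroup (G s₀)).tendsto (θ s₀)).comp (hθ s₀ hs₀)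
  have hState : Tendsto (fun s => freeGroup (θ s) (G s - G s₀)) (𝓝[S] s₀) (𝓝 0) := by
    rw [tendsto_zero_iff_norm_tendsto_zero]
    simpa only [norm_freeGroup, sub_self, norm_zero] using
      ((hG s₀ hs₀).tendsto.sub_const (G s₀)).norm
  simpa [ContinuousWithinAt, freeGroup_sub] using hState.add hTime

end FreeGroup

section Kernel

/-- The Gaussian `exp (-π b x²)`. For `b = 2πit` it is the symbol of the free Schroedinger group and
`b⁻¹` yields its kernel; `0 < b.re` regularises both. -/
def gaussian (b : ℂ) (x : ℝ) : ℂ := Complex.exp (-Real.pi * b * x ^ 2)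

theorem continuous_gaussian (b : ℂ) : Continuous (gaussian b) := by
  unfold gaussian
  fun_prop

theorem continuous_gaussian_param (x : ℝ) : Continuous fun b => gaussian b x := by
  unfold gaussian
  fun_prop

theorem norm_gaussian_le_one {b : ℂ} (hb : 0 ≤ b.re) (x : ℝ) : ‖gaussian b x‖ ≤ 1 := by
  have hre : (-Real.pi * b * x ^ 2 : ℂ).re = -(Real.pi * b.re * x ^ 2) := by
    rw [← Complex.ofReal_pow, Complex.re_mul_ofReal, ← Complex.ofReal_neg, Complex.re_ofReal_mul]
    ring
  rw [gaussian, Complex.norm_exp, Real.exp_le_one_iff, hre, neg_nonpos]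
  have := Real.pi_pos
  positivity

theorem memLp_gaussian_top {b : ℂ} (hb : 0 ≤ b.re) : MemLp (gaussian b) ∞ volume :=
  memLp_top_of_bound (continuous_gaussian b).aestronglyMeasurable 1
    (Eventually.of_forall (norm_gaussian_le_one hb))

theorem integrable_gaussian {b : ℂ} (hb : 0 < b.re) : Integrable (gaussian b) := by
  unfold gaussian
  simpa using integrable_cexp_quadratic' (b := -Real.pi * b)
    (by simpa using mul_pos Real.pi_pos hb) 0 0

theorem schrodingerSymbol_eq_gaussian (t : ℝ) :
    schrodingerSymbol t = gaussian (2 * Real.pi * t * Complex.I) := by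
  ext k
  rw [schrodingerSymbol, gaussian]
  congr 1
  push_cast
  ring

theorem fourierInv_gaussian_mul_fourier {f : ℝ → ℂ} (hf : Integrable f) {b : ℂ} (hb : 0 < b.re)
    (x : ℝ) :
    𝓕⁻ (fun k => gaussian b k * 𝓕 f k) x =
      1 / b ^ (1 / 2 : ℂ) * ∫ y, gaussian b⁻¹ (y - x) * f y := by
  have hint : Integrable fun k : ℝ =>
      Complex.exp (-Real.pi * b * k ^ 2 + 2 * Real.pi * (Complex.I * x) * k) := by
    simpa using integrable_cexp_quadratic' (b := -Real.pi * b)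
      (by simpa using mul_pos Real.pi_pos hb) (2 * Real.pi * (Complex.I * x)) 0
  calc 𝓕⁻ (fun k => gaussian b k * 𝓕 f k) x
      = ∫ k, 𝓕 f k • Complex.exp (-Real.pi * b * k ^ 2 + 2 * Real.pi * (Complex.I * x) * k) := by
        rw [Real.fourierInv_eq']
        congr with k
        have hphase : ((2 * Real.pi * inner ℝ k x : ℝ) : ℂ) * Complex.I =
            2 * Real.pi * (Complex.I * x) * k := by
          simp only [RCLike.inner_apply, conj_trivial]
          push_cast
          ring
        rw [gaussian, hphase, Complex.exp_add, smul_eq_mul, smul_eq_mul]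
        ring
    _ = ∫ y, f y • (1 / b ^ (1 / 2 : ℂ) * Complex.exp (-Real.pi / b *
          (y + Complex.I * (Complex.I * x)) ^ 2)) := by
        rw [integral_fourier_smul_eq hf hint, fourier_gaussian_pi' hb]
    _ = 1 / b ^ (1 / 2 : ℂ) * ∫ y, gaussian b⁻¹ (y - x) * f y := by
        rw [← integral_const_mul]
        congr with y
        rw [gaussian, ← mul_assoc Complex.I, Complex.I_mul_I, smul_eq_mul]
        push_cast
        ring_nf

/-- The quadratic phase `exp (i x² / 2t)`. -/
def chirp (t x : ℝ) : ℂ := Complex.exp (Complex.I * ((x ^ 2 / (2 * t) : ℝ) : ℂ))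

theorem norm_chirp (t x : ℝ) : ‖chirp t x‖ = 1 :=
  Complex.norm_exp_I_mul_ofReal _

theorem continuous_chirp (t : ℝ) : Continuous (chirp t) := by
  unfold chirp
  fun_prop

theorem memLp_chirp_mul {p : ℝ≥0∞} {f : ℝ → ℂ} (hf : MemLp f p volume) (t : ℝ) :
    MemLp (fun x => chirp t x * f x) p volume :=
  hf.congr_norm ((continuous_chirp t).aestronglyMeasurable.mul hf.1)
    (Eventually.of_forall fun x => by rw [norm_mul, norm_chirp, one_mul])

theorem integrable_chirp_mul {f : ℝ → ℂ} (hf : Integrable f) (t : ℝ) :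
    Integrable fun x => chirp t x * f x :=
  memLp_one_iff_integrable.1 (memLp_chirp_mul (memLp_one_iff_integrable.2 hf) t)

/-- The constant `(2π i t)^{-1/2}` of the free Schroedinger kernel. -/
def kernelConst (t : ℝ) : ℂ := 1 / (2 * Real.pi * t * Complex.I : ℂ) ^ (1 / 2 : ℂ)

theorem norm_kernelConst (t : ℝ) : ‖kernelConst t‖ = 1 / √(2 * Real.pi * |t|) := by
  have h : (1 / 2 : ℂ) = ((1 / 2 : ℝ) : ℂ) := by push_cast; rfl
  rw [kernelConst, norm_div, h, Complex.norm_cpow_real, ← Real.sqrt_eq_rpow]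
  simp [abs_of_pos Real.pi_pos]

theorem norm_kernelConst_sq (t : ℝ) : ‖kernelConst t‖ ^ 2 = 1 / (2 * Real.pi * |t|) := by
  rw [norm_kernelConst, div_pow, one_pow, Real.sq_sqrt (by have := Real.pi_pos; positivity)]

theorem gaussian_inv_sub_eq_chirp {t : ℝ} (ht : t ≠ 0) (x y : ℝ) :
    gaussian (2 * Real.pi * t * Complex.I)⁻¹ (y - x) =
      chirp t x * (Complex.exp (↑(-2 * Real.pi * y * (x / (2 * Real.pi * t))) * Complex.I)
        * chirp t y) := by
  have hpi : (Real.pi : ℂ) ≠ 0 := by exact_mod_cast Real.pi_ne_zero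
  have ht' : (t : ℂ) ≠ 0 := by exact_mod_cast ht
  rw [gaussian, chirp, chirp, ← Complex.exp_add, ← Complex.exp_add]
  congr 1
  push_cast
  field_simp
  ring_nf
  simp only [Complex.I_sq]
  ring

theorem kernelConst_mul_integral_gaussian {t : ℝ} (ht : t ≠ 0) (f : ℝ → ℂ) (x : ℝ) :
    kernelConst t * ∫ y, gaussian (2 * Real.pi * t * Complex.I)⁻¹ (y - x) * f y =
      kernelConst t * chirp t x * 𝓕 (fun y => chirp t y * f y) (x / (2 * Real.pi * t)) := by
  rw [Real.fourier_real_eq_integral_exp_smul, mul_assoc (kernelConst t),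
    ← integral_const_mul (chirp t x)]
  congr 2 with y
  rw [gaussian_inv_sub_eq_chirp ht, smul_eq_mul]
  ring

section Regularisation

variable {b : ℕ → ℂ} (hb : ∀ n, 0 < (b n).re)
include hb

theorem tendsto_fourierInv_gaussian_mul_fourier {b₀ : ℂ} (hb₀ : b₀ ∈ Complex.slitPlane)
    (hlim : Tendsto b atTop (𝓝 b₀)) {f : ℝ → ℂ} (hf : Integrable f) (x : ℝ) :
    Tendsto (fun n => 𝓕⁻ (fun k => gaussian (b n) k * 𝓕 f k) x) atTop
      (𝓝 (1 / b₀ ^ (1 / 2 : ℂ) * ∫ y, gaussian b₀⁻¹ (y - x) * f y)) := by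
  have hne : b₀ ≠ 0 := Complex.slitPlane_ne_zero hb₀
  simp only [fun n => fourierInv_gaussian_mul_fourier hf (hb n) x]
  refine (Tendsto.div tendsto_const_nhds ((continuousAt_cpow_const hb₀).tendsto.comp hlim)
    (by simp [hne])).mul ?_
  have hinv : ∀ n, 0 ≤ (b n)⁻¹.re := fun n => by
    rw [Complex.inv_re]
    exact div_nonneg (hb n).le (Complex.normSq_nonneg _)
  refine tendsto_integral_of_dominated_convergence (fun y => ‖f y‖) (fun n => ?_) hf.norm
    (fun n => Eventually.of_forall fun y => ?_) (Eventually.of_forall fun y => ?_)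
  · exact ((continuous_gaussian _).comp
      (continuous_id.sub continuous_const)).aestronglyMeasurable.mul hf.1
  · rw [norm_mul]
    exact mul_le_of_le_one_left (norm_nonneg _) (norm_gaussian_le_one (hinv n) _)
  · exact (((continuous_gaussian_param _).tendsto _).comp (hlim.inv₀ hne)).mul_const _

theorem tendsto_fourierInv_mulL2_gaussian {t : ℝ}
    (hlim : Tendsto b atTop (𝓝 (2 * Real.pi * t * Complex.I))) (f : L2) :
    Tendsto (fun n => (𝓕⁻ (mulL2 (gaussian (b n)) (memLp_gaussian_top (hb n).le) (𝓕 f)) : L2))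
      atTop (𝓝 (freeGroup t f)) := by
  rw [freeGroup_eq_fourierInv_mulL2]
  refine (continuous_fourierInv_L2.tendsto _).comp (tendsto_mulL2 _ _
    (fun n => norm_gaussian_le_one (hb n).le) (fun k => (norm_schrodingerSymbol t k).le)
    (fun k => ?_) (𝓕 f))
  rw [schrodingerSymbol_eq_gaussian]
  exact ((continuous_gaussian_param k).tendsto _).comp hlim

end Regularisation

theorem fourierInv_mulL2_gaussian_ae_eq {b : ℂ} (hb : 0 < b.re) {f : L2} (hf : Integrable f) :
    (𝓕⁻ (mulL2 (gaussian b) (memLp_gaussian_top hb.le) (𝓕 f)) : L2) =ᵐ[volume]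
      𝓕⁻ fun k => gaussian b k * 𝓕 (f : ℝ → ℂ) k := by
  have hae : mulL2 (gaussian b) (memLp_gaussian_top hb.le) (𝓕 f) =ᵐ[volume]
      fun k => gaussian b k * 𝓕 (f : ℝ → ℂ) k := by
    filter_upwards [mulL2_ae_eq (memLp_gaussian_top hb.le) (𝓕 f), fourier_coeFn_ae_eq hf]
      with k h1 h2
    rw [h1, h2]
  have hint : Integrable fun k => gaussian b k * 𝓕 (f : ℝ → ℂ) k :=
    (integrable_gaussian hb).mul_bdd (c := ∫ x, ‖f x‖) (continuous_fourier hf).aestronglyMeasurable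
      (Eventually.of_forall fun k => norm_fourier_le _ k)
  filter_upwards [fourierInv_coeFn_ae_eq ((integrable_congr hae).2 hint)] with x hx
  rw [hx, Real.fourierInv_congr_ae hae]

theorem freeGroup_ae_eq {t : ℝ} (ht : t ≠ 0) {f : L2} (hf : Integrable f) :
    freeGroup t f =ᵐ[volume] fun x =>
      kernelConst t * chirp t x * 𝓕 (fun y => chirp t y * f y) (x / (2 * Real.pi * t)) := by
  let b : ℕ → ℂ := fun n => ((1 / ((n : ℝ) + 1) : ℝ) : ℂ) + 2 * Real.pi * t * Complex.I
  have hb : ∀ n, 0 < (b n).re := fun n => by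
    have h : (2 * Real.pi * t * Complex.I : ℂ).re = 0 := by simp
    simp only [b, Complex.add_re, h, Complex.ofReal_re, add_zero]
    positivity
  have hlim : Tendsto b atTop (𝓝 (2 * Real.pi * t * Complex.I)) := by
    simpa [b] using ((Complex.continuous_ofReal.tendsto 0).comp
      tendsto_one_div_add_atTop_nhds_zero_nat).add_const (2 * Real.pi * t * Complex.I : ℂ)
  have hslit : (2 * Real.pi * t * Complex.I : ℂ) ∈ Complex.slitPlane :=
    Or.inr (by simp [ht, Real.pi_ne_zero])
  obtain ⟨ns, hns, hae⟩ := (tendstoInMeasure_of_tendsto_Lp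
    (tendsto_fourierInv_mulL2_gaussian hb hlim f)).exists_seq_tendsto_ae
  filter_upwards [hae, ae_all_iff.2 fun n => fourierInv_mulL2_gaussian_ae_eq (hb n) hf]
    with x hx1 hx2
  simp only [hx2] at hx1
  rw [← kernelConst_mul_integral_gaussian ht]
  exact tendsto_nhds_unique hx1
    ((tendsto_fourierInv_gaussian_mul_fourier hb hslit hlim hf x).comp hns.tendsto_atTop)

end Kernel

section DerivativeNorm

/-- The homogeneous Sobolev norm `‖∂ₓ v‖_{L²}` of an integrable function, through the Fourier
integral: the frequency of Mathlib's Fourier variable `k` is `2πk`. -/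
def dotH1 (v : ℝ → ℂ) : ℝ≥0∞ := eLpNorm (fun k : ℝ => |2 * Real.pi * k| • 𝓕 v k) 2 volume

theorem normHdot10_eq_dotH1 {g : L2} (hg : Integrable g) : normHdot10 g = dotH1 g := by
  refine eLpNorm_congr_ae ?_
  filter_upwards [fourier_coeFn_ae_eq hg] with k hk
  rw [hk]

theorem dotH1_congr_ae {v w : ℝ → ℂ} (h : v =ᵐ[volume] w) : dotH1 v = dotH1 w := by
  simp only [dotH1, Real.fourier_congr_ae h]

theorem integrable_translate_sub {v : ℝ → ℂ} (hv : Integrable v) (h : ℝ) :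
    Integrable fun x => v (x + h) - v x :=
  (hv.comp_add_right h).sub hv

theorem memLp_translate_sub {v : ℝ → ℂ} {p : ℝ≥0∞} (hv : MemLp v p volume) (h : ℝ) :
    MemLp (fun x => v (x + h) - v x) p volume :=
  (hv.comp_measurePreserving (measurePreserving_add_right volume h)).sub hv

theorem fourier_translate {E : Type*} [NormedAddCommGroup E] [NormedSpace ℂ E] (v : ℝ → E)
    (h k : ℝ) :
    𝓕 (fun x => v (x + h)) k =
      Complex.exp (Complex.I * ((2 * Real.pi * k * h : ℝ) : ℂ)) • 𝓕 v k := by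
  refine (congrFun (VectorFourier.fourierIntegral_comp_add_right Real.fourierChar volume
    (innerₗ ℝ) v h) k).trans ?_
  rw [Circle.smul_def, Real.fourierChar_apply]
  congr 2
  simp only [innerₗ_apply_apply, RCLike.inner_apply, conj_trivial]
  push_cast
  ring

theorem fourier_translate_sub {v : ℝ → ℂ} (hv : Integrable v) (h k : ℝ) :
    𝓕 (fun x => v (x + h) - v x) k =
      (Complex.exp (Complex.I * ((2 * Real.pi * k * h : ℝ) : ℂ)) - 1) * 𝓕 v k := by
  rw [fourier_sub_apply (hv.comp_add_right h) hv, fourier_translate, smul_eq_mul]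
  ring

theorem eLpNorm_translate_sub_le {v : ℝ → ℂ} (hv : Integrable v) (hv2 : MemLp v 2 volume) (h : ℝ) :
    eLpNorm (fun x => v (x + h) - v x) 2 volume ≤ ENNReal.ofReal |h| * dotH1 v := by
  rw [← eLpNorm_fourier (integrable_translate_sub hv h) (memLp_translate_sub hv2 h)]
  refine eLpNorm_le_mul_eLpNorm_of_ae_le_mul (Eventually.of_forall fun k => ?_) 2
  rw [fourier_translate_sub hv, norm_mul, norm_smul, ← mul_assoc]
  gcongr
  refine Real.norm_exp_I_mul_ofReal_sub_one_le.trans_eq ?_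
  rw [norm_mul, mul_comm, Real.norm_eq_abs, Real.norm_eq_abs, Real.norm_eq_abs, abs_abs]

theorem tendsto_difference_quotient_exp (a : ℝ) :
    Tendsto (fun n : ℕ => (((n : ℝ) + 1 : ℝ) : ℂ) *
      (Complex.exp (Complex.I * ((a * (1 / ((n : ℝ) + 1)) : ℝ) : ℂ)) - 1)) atTop
      (𝓝 (Complex.I * (a : ℂ))) := by
  have hderiv : HasDerivAt (fun h : ℝ => Complex.exp (Complex.I * ((a * h : ℝ) : ℂ)))
      (Complex.I * (a : ℂ)) 0 := by
    simpa using (((hasDerivAt_id (0 : ℝ)).const_mul a).ofReal_comp.const_mul Complex.I).cexp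
  have hstep : Tendsto (fun n : ℕ => 1 / ((n : ℝ) + 1)) atTop (𝓝[≠] 0) :=
    tendsto_nhdsWithin_iff.2 ⟨tendsto_one_div_add_atTop_nhds_zero_nat,
      Eventually.of_forall fun n => (Nat.one_div_pos_of_nat (α := ℝ)).ne'⟩
  refine (hderiv.tendsto_slope_zero.comp hstep).congr fun n => ?_
  simp

theorem eLpNorm_difference_quotient {v : ℝ → ℂ} (hv : Integrable v) (hv2 : MemLp v 2 volume)
    (n : ℕ) :
    eLpNorm (fun k => (((n : ℝ) + 1 : ℝ) : ℂ) * 𝓕 (fun x => v (x + 1 / ((n : ℝ) + 1)) - v x) k)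
      2 volume =
      ENNReal.ofReal ((n : ℝ) + 1) *
        eLpNorm (fun x => v (x + 1 / ((n : ℝ) + 1)) - v x) 2 volume := by
  rw [← eLpNorm_fourier (integrable_translate_sub hv _) (memLp_translate_sub hv2 _)]
  refine (eLpNorm_const_smul (((n : ℝ) + 1 : ℝ) : ℂ) _ 2 volume).trans ?_
  rw [← ofReal_norm, Complex.norm_real, Real.norm_of_nonneg n.cast_add_one_pos.le]

theorem dotH1_le_of_translate {v : ℝ → ℂ} (hv : Integrable v) (hv2 : MemLp v 2 volume)
    {K K' : ℝ≥0∞} (hK' : K' ≠ ∞)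
    (hK : ∀ h : ℝ, 0 < h → eLpNorm (fun x => v (x + h) - v x) 2 volume ≤
      ENNReal.ofReal h * (K + ENNReal.ofReal h * K')) :
    dotH1 v ≤ K := by
  let φ : ℕ → ℝ → ℂ := fun n k =>
    (((n : ℝ) + 1 : ℝ) : ℂ) * 𝓕 (fun x => v (x + 1 / ((n : ℝ) + 1)) - v x) k
  have hφ_meas : ∀ n, AEStronglyMeasurable (φ n) volume := fun n =>
    (continuous_const.mul
      (continuous_fourier (integrable_translate_sub hv _))).aestronglyMeasurable
  have hφ_lim : ∀ k, Tendsto (fun n => φ n k) atTop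
      (𝓝 (Complex.I * ((2 * Real.pi * k : ℝ) : ℂ) * 𝓕 v k)) := fun k => by
    simp only [φ, fourier_translate_sub hv, ← mul_assoc]
    exact (tendsto_difference_quotient_exp _).mul_const _
  have hφ_le : ∀ n, eLpNorm (φ n) 2 volume ≤ K + ENNReal.ofReal (1 / ((n : ℝ) + 1)) * K' := by
    intro n
    have hpos : (0 : ℝ) < (n : ℝ) + 1 := by positivity
    rw [eLpNorm_difference_quotient hv hv2]
    refine (mul_le_mul_right (hK _ (by positivity)) _).trans_eq ?_
    rw [← mul_assoc, ← ENNReal.ofReal_mul hpos.le, mul_one_div_cancel hpos.ne',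
      ENNReal.ofReal_one, one_mul]
  have hbound_lim : Tendsto (fun n : ℕ => K + ENNReal.ofReal (1 / ((n : ℝ) + 1)) * K') atTop
      (𝓝 (K + ENNReal.ofReal 0 * K')) :=
    tendsto_const_nhds.add (ENNReal.Tendsto.mul_const
      (ENNReal.tendsto_ofReal tendsto_one_div_add_atTop_nhds_zero_nat) (Or.inr hK'))
  calc dotH1 v = eLpNorm (fun k : ℝ => Complex.I * ((2 * Real.pi * k : ℝ) : ℂ) * 𝓕 v k) 2 volume :=
        eLpNorm_congr_norm_ae (Eventually.of_forall fun k => by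
          rw [norm_smul, norm_mul, norm_mul, Complex.norm_I, Complex.norm_real, one_mul,
            Real.norm_eq_abs, Real.norm_eq_abs, abs_abs])
    _ ≤ liminf (fun n => eLpNorm (φ n) 2 volume) atTop :=
        Lp.eLpNorm_lim_le_liminf_eLpNorm hφ_meas _ (Eventually.of_forall hφ_lim)
    _ ≤ liminf (fun n : ℕ => K + ENNReal.ofReal (1 / ((n : ℝ) + 1)) * K') atTop :=
        liminf_le_liminf (Eventually.of_forall hφ_le)
    _ = K := by rw [hbound_lim.liminf_eq, ENNReal.ofReal_zero, zero_mul, add_zero]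

end DerivativeNorm

section Cube

variable {E : Type*} [NormedAddCommGroup E] [NormedSpace ℝ E]

theorem norm_cube_sub_cube_le {a b : E} {M : ℝ} (ha : ‖a‖ ≤ M) (hb : ‖b‖ ≤ M) :
    ‖‖a‖ ^ 2 • a - ‖b‖ ^ 2 • b‖ ≤ 3 * M ^ 2 * ‖a - b‖ := by
  have hM : 0 ≤ M := (norm_nonneg a).trans ha
  have hsplit : ‖a‖ ^ 2 • a - ‖b‖ ^ 2 • b =
      ‖a‖ ^ 2 • (a - b) + ((‖a‖ - ‖b‖) * (‖a‖ + ‖b‖)) • b := by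
    module
  calc ‖‖a‖ ^ 2 • a - ‖b‖ ^ 2 • b‖
      ≤ ‖‖a‖ ^ 2 • (a - b)‖ + ‖((‖a‖ - ‖b‖) * (‖a‖ + ‖b‖)) • b‖ := hsplit ▸ norm_add_le _ _
    _ = ‖a‖ ^ 2 * ‖a - b‖ + |‖a‖ - ‖b‖| * (‖a‖ + ‖b‖) * ‖b‖ := by
        rw [norm_smul, norm_smul, norm_mul, norm_pow, norm_norm, Real.norm_eq_abs,
          Real.norm_of_nonneg (add_nonneg (norm_nonneg a) (norm_nonneg b))]
    _ ≤ M ^ 2 * ‖a - b‖ + ‖a - b‖ * (M + M) * M := by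
        gcongr
        exact abs_norm_sub_norm_le a b
    _ = 3 * M ^ 2 * ‖a - b‖ := by ring

theorem memLp_cube {X : Type*} [MeasurableSpace X] {μ : Measure X} {v : X → E} {p : ℝ≥0∞} {M : ℝ}
    (hv : MemLp v p μ) (hM : ∀ᵐ x ∂μ, ‖v x‖ ≤ M) : MemLp (fun x => ‖v x‖ ^ 2 • v x) p μ := by
  refine hv.of_le_mul (c := M ^ 2) ((hv.1.norm.pow 2).smul hv.1) ?_
  filter_upwards [hM] with x hx
  rw [norm_smul, norm_pow, norm_norm]
  gcongr

theorem eLpNorm_cube_sub_cube_le {X : Type*} [MeasurableSpace X] {μ : Measure X} {v w : X → E}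
    {M : ℝ} (p : ℝ≥0∞) (hv : ∀ᵐ x ∂μ, ‖v x‖ ≤ M) (hw : ∀ᵐ x ∂μ, ‖w x‖ ≤ M) :
    eLpNorm (fun x => ‖v x‖ ^ 2 • v x - ‖w x‖ ^ 2 • w x) p μ ≤
      ENNReal.ofReal (3 * M ^ 2) * eLpNorm (fun x => v x - w x) p μ := by
  refine eLpNorm_le_mul_eLpNorm_of_ae_le_mul ?_ p
  filter_upwards [hv, hw] with x hvx hwx using norm_cube_sub_cube_le hvx hwx

theorem dotH1_cube_le {v : ℝ → ℂ} {M : ℝ} (hv : Integrable v) (hv2 : MemLp v 2 volume)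
    (hM : ∀ᵐ x, ‖v x‖ ≤ M) :
    dotH1 (fun x => ‖v x‖ ^ 2 • v x) ≤ ENNReal.ofReal (3 * M ^ 2) * dotH1 v := by
  have hcube := memLp_one_iff_integrable.1 (memLp_cube (memLp_one_iff_integrable.2 hv) hM)
  refine dotH1_le_of_translate hcube (memLp_cube hv2 hM) ENNReal.zero_ne_top fun h hh => ?_
  have hM_translate : ∀ᵐ x, ‖v (x + h)‖ ≤ M :=
    (measurePreserving_add_right volume h).quasiMeasurePreserving.ae hM
  rw [mul_zero, add_zero, mul_left_comm]
  refine (eLpNorm_cube_sub_cube_le 2 hM_translate hM).trans ?_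
  gcongr
  simpa only [abs_of_pos hh] using eLpNorm_translate_sub_le hv hv2 h

end Cube

section ChirpMultiplication

theorem norm_exp_I_sub_exp_I_le (a b : ℝ) :
    ‖Complex.exp (Complex.I * (a : ℂ)) - Complex.exp (Complex.I * (b : ℂ))‖ ≤ |a - b| := by
  have hfactor : Complex.exp (Complex.I * (a : ℂ)) - Complex.exp (Complex.I * (b : ℂ)) =
      Complex.exp (Complex.I * (b : ℂ)) * (Complex.exp (Complex.I * ((a - b : ℝ) : ℂ)) - 1) := by
    rw [mul_sub, ← Complex.exp_add, mul_one]
    congr 2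
    push_cast
    ring
  rw [hfactor, norm_mul, Complex.norm_exp_I_mul_ofReal, one_mul]
  exact Real.norm_exp_I_mul_ofReal_sub_one_le

theorem norm_chirp_translate_sub_le {t : ℝ} (ht : t ≠ 0) {h : ℝ} (hh : 0 < h) (x : ℝ) :
    ‖chirp t (x + h) - chirp t x‖ ≤ h * (|t|⁻¹ * |x| + h * (2 * |t|)⁻¹) := by
  refine (norm_exp_I_sub_exp_I_le _ _).trans ?_
  have hphase : (x + h) ^ 2 / (2 * t) - x ^ 2 / (2 * t) = h * (t⁻¹ * x + h * (2 * t)⁻¹) := by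
    field_simp
    ring
  rw [hphase, abs_mul, abs_of_pos hh]
  gcongr
  refine (abs_add_le _ _).trans_eq ?_
  rw [abs_mul, abs_mul, abs_inv, abs_inv, abs_mul, abs_two, abs_of_pos hh]

theorem eLpNorm_chirp_translate_sub_mul_le {t : ℝ} (ht : t ≠ 0) {v : ℝ → ℂ}
    (hv : AEStronglyMeasurable v volume) {h : ℝ} (hh : 0 < h) :
    eLpNorm (fun x => (chirp t (x + h) - chirp t x) * v x) 2 volume ≤
      ENNReal.ofReal h * (ENNReal.ofReal |t|⁻¹ * eLpNorm (fun x => |x| • v x) 2 volume +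
        ENNReal.ofReal h * (ENNReal.ofReal (2 * |t|)⁻¹ * eLpNorm v 2 volume)) := by
  have hxv : AEStronglyMeasurable (fun x : ℝ => |x| • ‖v x‖) volume :=
    continuous_abs.aestronglyMeasurable.smul hv.norm
  have hxv_norm : eLpNorm (fun x : ℝ => |x| • ‖v x‖) 2 volume =
      eLpNorm (fun x => |x| • v x) 2 volume :=
    eLpNorm_congr_norm_ae (Eventually.of_forall fun x => by rw [norm_smul, norm_smul, norm_norm])
  calc eLpNorm (fun x => (chirp t (x + h) - chirp t x) * v x) 2 volume
      ≤ ENNReal.ofReal h * eLpNorm (|t|⁻¹ • (fun x => |x| • ‖v x‖) +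
          (h * (2 * |t|)⁻¹) • fun x => ‖v x‖) 2 volume := by
        refine eLpNorm_le_mul_eLpNorm_of_ae_le_mul (Eventually.of_forall fun x => ?_) 2
        have hx := mul_le_mul_of_nonneg_right (norm_chirp_translate_sub_le ht hh x)
          (norm_nonneg (v x))
        simp only [Pi.add_apply, Pi.smul_apply, smul_eq_mul]
        rw [norm_mul, Real.norm_of_nonneg (by positivity)]
        linarith
    _ ≤ ENNReal.ofReal h * (eLpNorm (|t|⁻¹ • fun x => |x| • ‖v x‖) 2 volume +
          eLpNorm ((h * (2 * |t|)⁻¹) • fun x => ‖v x‖) 2 volume) := by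
        gcongr
        exact eLpNorm_add_le (hxv.const_smul _) (hv.norm.const_smul _) one_le_two
    _ = _ := by
        rw [eLpNorm_const_smul, eLpNorm_const_smul, Real.enorm_of_nonneg (by positivity),
          Real.enorm_of_nonneg (by positivity), ENNReal.ofReal_mul hh.le, mul_assoc, eLpNorm_norm,
          hxv_norm]

theorem dotH1_chirp_mul_le {t : ℝ} (ht : t ≠ 0) {v : ℝ → ℂ} (hv : Integrable v)
    (hv2 : MemLp v 2 volume) :
    dotH1 (fun x => chirp t x * v x) ≤
      dotH1 v + ENNReal.ofReal |t|⁻¹ * eLpNorm (fun x => |x| • v x) 2 volume := by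
  refine dotH1_le_of_translate (K' := ENNReal.ofReal (2 * |t|)⁻¹ * eLpNorm v 2 volume)
    (integrable_chirp_mul hv t) (memLp_chirp_mul hv2 t)
    (ENNReal.mul_ne_top ENNReal.ofReal_ne_top hv2.2.ne) fun h hh => ?_
  have hchirp : Continuous fun x => chirp t (x + h) :=
    (continuous_chirp t).comp (continuous_add_const h)
  have hdiff : eLpNorm (fun x => chirp t (x + h) * (v (x + h) - v x)) 2 volume ≤
      ENNReal.ofReal h * dotH1 v := by
    rw [← abs_of_pos hh]
    refine le_of_eq_of_le ?_ (eLpNorm_translate_sub_le hv hv2 _)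
    rw [abs_of_pos hh]
    exact eLpNorm_congr_norm_ae (Eventually.of_forall fun x => by
      rw [norm_mul, norm_chirp, one_mul])
  calc eLpNorm (fun x => chirp t (x + h) * v (x + h) - chirp t x * v x) 2 volume
      = eLpNorm ((fun x => chirp t (x + h) * (v (x + h) - v x)) +
          fun x => (chirp t (x + h) - chirp t x) * v x) 2 volume := by
        congr 1
        ext x
        simp only [Pi.add_apply]
        ring
    _ ≤ _ := eLpNorm_add_le
        (hchirp.aestronglyMeasurable.mul (memLp_translate_sub hv2 h).1)
        ((hchirp.sub (continuous_chirp t)).aestronglyMeasurable.mul hv2.1) one_le_two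
    _ ≤ _ := add_le_add hdiff (eLpNorm_chirp_translate_sub_mul_le ht hv2.1 hh)
    _ = _ := by ring

theorem eLpNorm_comp_div {E : Type*} [NormedAddCommGroup E] {p : ℝ≥0∞} (hp : p ≠ ∞) (φ : ℝ → E)
    {c : ℝ} (hc : c ≠ 0) :
    eLpNorm (fun x => φ (x / c)) p volume =
      ENNReal.ofReal |c| ^ (1 / p).toReal * eLpNorm φ p volume := by
  have hcomp : (fun x => φ (x / c)) = φ ∘ (c⁻¹ * ·) := by
    ext x
    rw [Function.comp_apply, div_eq_inv_mul]
  have hemb : MeasurableEmbedding (c⁻¹ * ·) :=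
    (Homeomorph.mulLeft₀ c⁻¹ (inv_ne_zero hc)).measurableEmbedding
  rw [hcomp, ← hemb.eLpNorm_map_measure, Real.map_volume_mul_left (inv_ne_zero hc), inv_inv,
    eLpNorm_smul_measure_of_ne_top hp, smul_eq_mul]

theorem normHdot01_freeGroup {t : ℝ} (ht : t ≠ 0) {f : L2} (hf : Integrable f) :
    normHdot01 (freeGroup t f) = ENNReal.ofReal |t| * dotH1 (fun y => chirp t y * f y) := by
  have hc : 2 * Real.pi * t ≠ 0 := mul_ne_zero Real.two_pi_pos.ne' ht
  have habs : |2 * Real.pi * t| = 2 * Real.pi * |t| := by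
    rw [abs_mul, abs_of_pos Real.two_pi_pos]
  let φ : ℝ → ℂ := fun k => |2 * Real.pi * k| • 𝓕 (fun y => chirp t y * f y) k
  have hdilate : normHdot01 (freeGroup t f) =
      eLpNorm ((|t| * ‖kernelConst t‖) • fun x => φ (x / (2 * Real.pi * t))) 2 volume := by
    refine eLpNorm_congr_norm_ae ?_
    filter_upwards [freeGroup_ae_eq ht hf] with x hx
    have hcancel : |2 * Real.pi * (x / (2 * Real.pi * t))| = |x| / |t| := by
      rw [← mul_div_assoc, mul_div_mul_left _ _ Real.two_pi_pos.ne', abs_div]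
    simp only [hx, Pi.smul_apply, φ, norm_smul, norm_mul, norm_chirp, mul_one, Real.norm_eq_abs,
      abs_abs, abs_norm, abs_div, hcancel]
    have := abs_ne_zero.2 ht
    field_simp
  have hroot : ENNReal.ofReal |2 * Real.pi * t| ^ (1 / 2 : ℝ≥0∞).toReal =
      ENNReal.ofReal √(2 * Real.pi * |t|) := by
    rw [Real.sqrt_eq_rpow, habs, ENNReal.ofReal_rpow_of_nonneg (by positivity) (by norm_num)]
    simp
  rw [hdilate, eLpNorm_const_smul, eLpNorm_comp_div ENNReal.ofNat_ne_top φ hc,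
    Real.enorm_of_nonneg (by positivity), hroot, ← mul_assoc,
    ← ENNReal.ofReal_mul (by positivity), norm_kernelConst, mul_assoc, one_div,
    inv_mul_cancel₀ (Real.sqrt_pos.2 (by have := Real.pi_pos; positivity)).ne', mul_one]
  rfl

end ChirpMultiplication

section WeightedNorm

/-- The weight `m`, cut off to the set where it is at most `n`. -/
def truncate {X : Type*} (m : X → ℝ) (n : ℕ) : X → ℂ := {x | |m x| ≤ n}.indicator fun x => (m x : ℂ)

theorem tendsto_truncate {X : Type*} (m : X → ℝ) (x : X) :
    Tendsto (fun n => truncate m n x) atTop (𝓝 (m x : ℂ)) := by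
  refine tendsto_const_nhds.congr' ?_
  obtain ⟨N, hN⟩ := exists_nat_ge |m x|
  filter_upwards [eventually_ge_atTop N] with n hn
  have hx : x ∈ {x | |m x| ≤ n} := hN.trans (Nat.cast_le.2 hn)
  rw [truncate, indicator_of_mem hx]

variable {X : Type*} [MeasurableSpace X] {μ : Measure X} {m : X → ℝ}

/-- The weighted norm `‖m g‖_{L²}` of `g`; applied to the Fourier transform of `g` it also gives the
Sobolev norms. -/
def weightedNorm (m : X → ℝ) (g : Lp ℂ 2 μ) : ℝ≥0∞ := eLpNorm (fun x => m x • g x) 2 μ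

theorem weightedNorm_mono {m' : X → ℝ} (h : ∀ x, |m x| ≤ |m' x|) (g : Lp ℂ 2 μ) :
    weightedNorm m g ≤ weightedNorm m' g := by
  refine eLpNorm_mono fun x => ?_
  rw [norm_smul, norm_smul]
  exact mul_le_mul_of_nonneg_right (h x) (norm_nonneg _)

theorem memLp_truncate (hm : Measurable m) (n : ℕ) : MemLp (truncate m n) ∞ μ := by
  refine memLp_top_of_bound ((Complex.measurable_ofReal.comp hm).indicator
    (measurableSet_le hm.norm measurable_const)).aestronglyMeasurable n
    (Eventually.of_forall fun x => ?_)
  by_cases hx : |m x| ≤ n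
  · rwa [truncate, indicator_of_mem (by exact hx), Complex.norm_real]
  · rw [truncate, indicator_of_notMem (by exact hx), norm_zero]
    exact n.cast_nonneg

/-- As a supremum of norms of bounded operators, a weighted norm inherits the triangle inequality,
homogeneity and Minkowski's integral inequality without any finiteness assumption. -/
theorem weightedNorm_eq_iSup (hm : Measurable m) (g : Lp ℂ 2 μ) :
    weightedNorm m g = ⨆ n, ‖mulL2 (truncate m n) (memLp_truncate hm n) g‖ₑ := by
  have henorm : ∀ n, ‖mulL2 (truncate m n) (memLp_truncate hm n) g‖ₑ =
      eLpNorm (fun x => truncate m n x * g x) 2 μ := fun n => by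
    rw [Lp.enorm_def, eLpNorm_congr_ae (mulL2_ae_eq _ g)]
  have hweight : weightedNorm m g = eLpNorm (fun x => (m x : ℂ) * g x) 2 μ :=
    congrArg (eLpNorm · 2 μ) (funext fun x => Complex.real_smul)
  simp only [henorm]
  refine le_antisymm ?_ (iSup_le fun n => ?_)
  · rw [hweight]
    refine (Lp.eLpNorm_lim_le_liminf_eLpNorm
      (fun n => (memLp_truncate hm n).1.mul (Lp.aestronglyMeasurable g)) _
      (Eventually.of_forall fun x => (tendsto_truncate m x).mul_const _)).trans ?_
    exact liminf_le_of_le (by isBoundedDefault) fun b hb =>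
      let ⟨n, hn⟩ := hb.exists; hn.trans (le_iSup (fun n => eLpNorm _ 2 μ) n)
  · rw [hweight]
    refine eLpNorm_mono fun x => ?_
    rw [norm_mul, norm_mul]
    exact mul_le_mul_of_nonneg_right (norm_indicator_le_norm_self _ x) (norm_nonneg _)

theorem weightedNorm_add_le (hm : Measurable m) (f g : Lp ℂ 2 μ) :
    weightedNorm m (f + g) ≤ weightedNorm m f + weightedNorm m g := by
  simp only [weightedNorm_eq_iSup hm, map_add]
  exact iSup_le fun n => (enorm_add_le _ _).trans (add_le_add (le_iSup_iff.2 fun _ h => h n)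
    (le_iSup_iff.2 fun _ h => h n))

theorem weightedNorm_smul (hm : Measurable m) (c : ℂ) (g : Lp ℂ 2 μ) :
    weightedNorm m (c • g) = ‖c‖ₑ * weightedNorm m g := by
  simp only [weightedNorm_eq_iSup hm, map_smul, enorm_smul, ENNReal.mul_iSup]

theorem weightedNorm_integral_le (hm : Measurable m) {Y : Type*} [MeasurableSpace Y]
    {ν : Measure Y} {F : Y → Lp ℂ 2 μ} (hF : Integrable F ν) :
    weightedNorm m (∫ y, F y ∂ν) ≤ ∫⁻ y, weightedNorm m (F y) ∂ν := by
  simp only [weightedNorm_eq_iSup hm]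
  refine iSup_le fun n => ?_
  rw [← ContinuousLinearMap.integral_comp_comm _ hF]
  exact (enorm_integral_le_lintegral_enorm _).trans
    (lintegral_mono fun y => le_iSup_iff.2 fun _ h => h n)

end WeightedNorm

section SobolevNorms

theorem normHdot10_eq_weightedNorm (g : L2) :
    normHdot10 g = weightedNorm (fun k => |2 * Real.pi * k|) (𝓕 g : L2) := rfl

theorem normH10_eq_weightedNorm (g : L2) :
    normH10 g = weightedNorm (fun k => √(1 + (2 * Real.pi * k) ^ 2)) (𝓕 g : L2) := rfl

theorem fourier_integral_L2 {Y : Type*} [MeasurableSpace Y] {ν : Measure Y} {F : Y → L2}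
    (hF : Integrable F ν) : (𝓕 (∫ y, F y ∂ν) : L2) = ∫ y, 𝓕 (F y) ∂ν :=
  ((Lp.fourierTransformₗᵢ ℝ ℂ).toContinuousLinearEquiv.toContinuousLinearMap.integral_comp_comm
    hF).symm

theorem normHdot01_add_le (f g : L2) : normHdot01 (f + g) ≤ normHdot01 f + normHdot01 g :=
  weightedNorm_add_le continuous_abs.measurable f g

theorem normHdot10_add_le (f g : L2) : normHdot10 (f + g) ≤ normHdot10 f + normHdot10 g := by
  have hadd : (𝓕 (f + g) : L2) = 𝓕 f + 𝓕 g := map_add (Lp.fourierTransformₗᵢ ℝ ℂ) f g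
  simp only [normHdot10_eq_weightedNorm, hadd]
  exact weightedNorm_add_le (by fun_prop) _ _

theorem normH01_add_le (f g : L2) : normH01 (f + g) ≤ normH01 f + normH01 g :=
  weightedNorm_add_le (by fun_prop) f g

theorem normH10_add_le (f g : L2) : normH10 (f + g) ≤ normH10 f + normH10 g := by
  have hadd : (𝓕 (f + g) : L2) = 𝓕 f + 𝓕 g := map_add (Lp.fourierTransformₗᵢ ℝ ℂ) f g
  simp only [normH10_eq_weightedNorm, hadd]
  exact weightedNorm_add_le (by fun_prop) _ _

theorem normHdot01_smul (c : ℂ) (g : L2) : normHdot01 (c • g) = ‖c‖ₑ * normHdot01 g :=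
  weightedNorm_smul continuous_abs.measurable c g

theorem normHdot10_smul (c : ℂ) (g : L2) : normHdot10 (c • g) = ‖c‖ₑ * normHdot10 g := by
  have hsmul : (𝓕 (c • g) : L2) = c • 𝓕 g := map_smul (Lp.fourierTransformₗᵢ ℝ ℂ) c g
  simp only [normHdot10_eq_weightedNorm, hsmul]
  exact weightedNorm_smul (by fun_prop) c _

theorem normHdot01_integral_le {Y : Type*} [MeasurableSpace Y] {ν : Measure Y} {F : Y → L2}
    (hF : Integrable F ν) : normHdot01 (∫ y, F y ∂ν) ≤ ∫⁻ y, normHdot01 (F y) ∂ν :=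
  weightedNorm_integral_le continuous_abs.measurable hF

theorem normHdot10_integral_le {Y : Type*} [MeasurableSpace Y] {ν : Measure Y} {F : Y → L2}
    (hF : Integrable F ν) : normHdot10 (∫ y, F y ∂ν) ≤ ∫⁻ y, normHdot10 (F y) ∂ν := by
  simp only [normHdot10_eq_weightedNorm, fourier_integral_L2 hF]
  exact weightedNorm_integral_le (by fun_prop)
    ((Lp.fourierTransformₗᵢ ℝ ℂ).integrable_comp_iff.2 hF)

theorem normHdot01_le_normH01 (g : L2) : normHdot01 g ≤ normH01 g :=
  weightedNorm_mono (fun x => by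
    rw [abs_abs, abs_of_nonneg (Real.sqrt_nonneg _)]
    exact Real.abs_le_sqrt (by linarith)) g

theorem normHdot10_le_normH10 (g : L2) : normHdot10 g ≤ normH10 g :=
  weightedNorm_mono (fun k => by
    rw [abs_abs, abs_of_nonneg (Real.sqrt_nonneg _)]
    exact Real.abs_le_sqrt (by linarith)) (𝓕 g : L2)

theorem enorm_le_normH01 (g : L2) : ‖g‖ₑ ≤ normH01 g := by
  rw [Lp.enorm_def]
  refine eLpNorm_mono fun x => ?_
  rw [norm_smul, Real.norm_of_nonneg (Real.sqrt_nonneg _)]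
  exact le_mul_of_one_le_left (norm_nonneg _) (Real.one_le_sqrt.2 (by linarith [sq_nonneg x]))

theorem normH01_le (g : L2) : normH01 g ≤ ‖g‖ₑ + normHdot01 g := by
  have hxg : AEStronglyMeasurable (fun x : ℝ => |x| • g x) volume :=
    continuous_abs.aestronglyMeasurable.smul (Lp.aestronglyMeasurable g)
  calc normH01 g ≤ eLpNorm ((fun x => ‖g x‖) + fun x => ‖|x| • g x‖) 2 volume := by
        refine eLpNorm_mono fun x => ?_
        have hsqrt : √(1 + x ^ 2) ≤ 1 + |x| :=
          (Real.sqrt_le_left (by positivity)).2 (by nlinarith [sq_abs x, abs_nonneg x])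
        simp only [Pi.add_apply, norm_smul, Real.norm_eq_abs, abs_abs]
        rw [abs_of_nonneg (Real.sqrt_nonneg _), abs_of_nonneg (by positivity)]
        nlinarith [norm_nonneg (g x)]
    _ ≤ eLpNorm (fun x => ‖g x‖) 2 volume + eLpNorm (fun x => ‖|x| • g x‖) 2 volume :=
        eLpNorm_add_le (Lp.aestronglyMeasurable g).norm hxg.norm one_le_two
    _ = ‖g‖ₑ + normHdot01 g := by rw [eLpNorm_norm, eLpNorm_norm, Lp.enorm_def, normHdot01]

end SobolevNorms

section WeightedIntegrals

theorem lintegral_inv_sq_add {t : ℝ} (ht : 0 < t) :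
    ∫⁻ x : ℝ, ENNReal.ofReal (x ^ 2 + t)⁻¹ = ENNReal.ofReal (Real.pi / √t) := by
  have hs : 0 < √t := Real.sqrt_pos.2 ht
  have hscale : (fun x : ℝ => (x ^ 2 + t)⁻¹) = fun x => t⁻¹ * (1 + (x / √t) ^ 2)⁻¹ := by
    ext x
    rw [div_pow, Real.sq_sqrt ht.le]
    field_simp
    ring
  have hint : Integrable fun x : ℝ => (x ^ 2 + t)⁻¹ := by
    rw [hscale]
    exact (integrable_inv_one_add_sq.comp_div hs.ne').const_mul _
  rw [← ofReal_integral_eq_lintegral_ofReal hint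
    (Eventually.of_forall fun x => inv_nonneg.2 (add_nonneg (sq_nonneg x) ht.le)), hscale,
    integral_const_mul, Measure.integral_comp_div (fun x : ℝ => (1 + x ^ 2)⁻¹),
    integral_univ_inv_one_add_sq, abs_of_pos hs, smul_eq_mul]
  congr 1
  nth_rewrite 1 [← Real.sq_sqrt ht.le]
  field_simp

theorem rpow_ofReal_pi_div_sqrt {t : ℝ} (ht : 0 < t) :
    ENNReal.ofReal (Real.pi / √t) ^ (1 / 2 : ℝ) =
      ENNReal.ofReal (√Real.pi * t ^ (-1 / 4 : ℝ)) := by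
  have hpi := Real.pi_pos
  rw [ENNReal.ofReal_rpow_of_nonneg (by positivity) (by norm_num), ← Real.sqrt_eq_rpow,
    Real.sqrt_div hpi.le, Real.sqrt_eq_rpow √t, Real.sqrt_eq_rpow t, ← Real.rpow_mul ht.le,
    div_eq_mul_inv, ← Real.rpow_neg ht.le]
  norm_num

theorem lintegral_inv_sqrt_mul_enorm_le {E : Type*} [NormedAddCommGroup E] {t : ℝ} (ht : 0 < t)
    {f : ℝ → E} (hf : AEStronglyMeasurable f volume) :
    ∫⁻ x : ℝ, ENNReal.ofReal (√(x ^ 2 + t))⁻¹ * ‖f x‖ₑ ≤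
      ENNReal.ofReal (√Real.pi * t ^ (-1 / 4 : ℝ)) * eLpNorm f 2 volume := by
  have hsq : ∀ x : ℝ, ENNReal.ofReal (√(x ^ 2 + t))⁻¹ ^ 2 = ENNReal.ofReal (x ^ 2 + t)⁻¹ := by
    intro x
    rw [← ENNReal.ofReal_pow (by positivity), inv_pow, Real.sq_sqrt (by positivity)]
  refine (ENNReal.lintegral_mul_le_Lp_mul_Lq volume Real.HolderConjugate.two_two
    (by fun_prop) hf.enorm).trans_eq ?_
  simp only [ENNReal.rpow_two]
  rw [lintegral_congr hsq, lintegral_inv_sq_add ht, rpow_ofReal_pi_div_sqrt ht,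
    eLpNorm_two_eq_lintegral]

theorem eLpNorm_one_le_normH01 (g : L2) :
    eLpNorm g 1 volume ≤ ENNReal.ofReal √Real.pi * normH01 g := by
  have hm : AEStronglyMeasurable (fun x : ℝ => √(1 + x ^ 2) • g x) volume :=
    (by fun_prop : Continuous fun x : ℝ => √(1 + x ^ 2)).aestronglyMeasurable.smul
      (Lp.aestronglyMeasurable g)
  have hcs := lintegral_inv_sqrt_mul_enorm_le one_pos hm
  rw [Real.one_rpow, mul_one] at hcs
  rw [eLpNorm_one_eq_lintegral_enorm]
  refine le_of_eq_of_le (lintegral_congr fun x => ?_) hcs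
  rw [enorm_smul, ← mul_assoc, Real.enorm_of_nonneg (by positivity),
    ← ENNReal.ofReal_mul (by positivity), add_comm, inv_mul_cancel₀ (by positivity),
    ENNReal.ofReal_one, one_mul]

theorem integrable_of_normH01_ne_top {g : L2} (h : normH01 g ≠ ∞) : Integrable g :=
  memLp_one_iff_integrable.1 ⟨Lp.aestronglyMeasurable g,
    (eLpNorm_one_le_normH01 g).trans_lt (ENNReal.mul_lt_top ENNReal.ofReal_lt_top h.lt_top)⟩

theorem integrable_of_normHdot01_ne_top {g : L2} (h : normHdot01 g ≠ ∞) : Integrable g :=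
  integrable_of_normH01_ne_top
    ((normH01_le g).trans_lt (ENNReal.add_lt_top.2 ⟨enorm_lt_top, h.lt_top⟩)).ne

end WeightedIntegrals

section FourierMultiplicationDecay

theorem three_mul_sq_div_le {t x : ℝ} (ht : 0 < t) :
    3 * x ^ 2 / (x ^ 2 + t) ≤ 3 * (√(x ^ 2 + t))⁻¹ * |x| := by
  have hpos : 0 < x ^ 2 + t := by positivity
  have hsqrt : 0 < √(x ^ 2 + t) := Real.sqrt_pos.2 hpos
  have habs : |x| ≤ √(x ^ 2 + t) := Real.abs_le_sqrt (by linarith)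
  rw [div_le_iff₀ hpos]
  nth_rewrite 2 [← Real.sq_sqrt hpos.le]
  field_simp
  nlinarith [sq_abs x, mul_le_mul_of_nonneg_right habs (abs_nonneg x)]

/-- The hypothesis on `m` holds for multipliers that are close to `1` where `x² ≪ t`. -/
theorem enorm_fourier_mul_sub_le {m f : ℝ → ℂ} {t : ℝ} (ht : 0 < t)
    (hm : AEStronglyMeasurable m volume) (hm_sub : ∀ x, ‖m x - 1‖ ≤ 3 * x ^ 2 / (x ^ 2 + t))
    (hf : Integrable f) (k : ℝ) :
    ‖𝓕 (fun x => m x * f x) k - 𝓕 f k‖ₑ ≤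
      ENNReal.ofReal (3 * √Real.pi * t ^ (-1 / 4 : ℝ)) * eLpNorm (fun x => |x| • f x) 2 volume := by
  have hm_le : ∀ x, ‖m x‖ ≤ 4 := fun x => by
    have hle : 3 * x ^ 2 / (x ^ 2 + t) ≤ 3 := by
      rw [div_le_iff₀ (by positivity)]
      linarith
    have htriangle := norm_add_le (m x - 1) 1
    rw [sub_add_cancel, norm_one] at htriangle
    linarith [hm_sub x]
  have hxf : AEStronglyMeasurable (fun x : ℝ => |x| • f x) volume :=
    continuous_abs.aestronglyMeasurable.smul hf.1
  rw [← fourier_sub_apply (hf.bdd_mul hm (Eventually.of_forall hm_le)) hf]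
  calc ‖𝓕 (fun x => m x * f x - f x) k‖ₑ
      ≤ ∫⁻ x, ‖m x * f x - f x‖ₑ := by
        rw [← eLpNorm_one_eq_lintegral_enorm]
        exact enorm_fourier_le _ k
    _ ≤ ∫⁻ x : ℝ, ENNReal.ofReal 3 * (ENNReal.ofReal (√(x ^ 2 + t))⁻¹ * ‖|x| • f x‖ₑ) := by
        refine lintegral_mono fun x => ?_
        rw [← sub_one_mul, enorm_mul, enorm_smul, ← mul_assoc, ← mul_assoc, Real.enorm_abs,
          ← Real.enorm_abs, Real.enorm_of_nonneg (abs_nonneg x), ← ofReal_norm,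
          ← ENNReal.ofReal_mul (by positivity), ← ENNReal.ofReal_mul (by positivity)]
        gcongr
        exact (hm_sub x).trans (three_mul_sq_div_le ht)
    _ ≤ ENNReal.ofReal 3 * (ENNReal.ofReal (√Real.pi * t ^ (-1 / 4 : ℝ)) *
          eLpNorm (fun x => |x| • f x) 2 volume) := by
        rw [lintegral_const_mul' _ _ ENNReal.ofReal_ne_top]
        gcongr
        exact lintegral_inv_sqrt_mul_enorm_le ht hxf
    _ = _ := by
        rw [← mul_assoc, ← ENNReal.ofReal_mul zero_le_three, mul_assoc 3]

theorem norm_chirp_sub_one_le {t : ℝ} (ht : 0 < t) (x : ℝ) :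
    ‖chirp t x - 1‖ ≤ 3 * x ^ 2 / (x ^ 2 + t) := by
  rcases le_total (x ^ 2) (5 * t) with h | h
  · calc ‖chirp t x - 1‖ ≤ ‖x ^ 2 / (2 * t)‖ := Real.norm_exp_I_mul_ofReal_sub_one_le
      _ = x ^ 2 / (2 * t) := Real.norm_of_nonneg (by positivity)
      _ ≤ 3 * x ^ 2 / (x ^ 2 + t) := by
        rw [div_le_div_iff₀ (by positivity) (by positivity)]
        nlinarith [sq_nonneg x]
  · calc ‖chirp t x - 1‖ ≤ ‖chirp t x‖ + ‖(1 : ℂ)‖ := norm_sub_le _ _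
      _ = 2 := by rw [norm_chirp, norm_one, one_add_one_eq_two]
      _ ≤ 3 * x ^ 2 / (x ^ 2 + t) := by
        rw [le_div_iff₀ (by positivity)]
        linarith

/-- The sharp cutoff to `x² ≤ t`. -/
def cutoff (t : ℝ) : ℝ → ℂ := indicator {x | x ^ 2 ≤ t} 1

theorem measurableSet_sq_le (t : ℝ) : MeasurableSet {x : ℝ | x ^ 2 ≤ t} :=
  measurableSet_le (by fun_prop) measurable_const

theorem volume_sq_le_ne_top (t : ℝ) : volume {x : ℝ | x ^ 2 ≤ t} ≠ ∞ := by
  have hsubset : {x : ℝ | x ^ 2 ≤ t} ⊆ Icc (-√t) √t :=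
    fun x hx => abs_le.1 (Real.abs_le_sqrt hx)
  exact measure_ne_top_of_subset hsubset measure_Icc_lt_top.ne

theorem norm_cutoff_sub_one_le {t : ℝ} (ht : 0 < t) (x : ℝ) :
    ‖cutoff t x - 1‖ ≤ 3 * x ^ 2 / (x ^ 2 + t) := by
  by_cases hx : x ^ 2 ≤ t
  · rw [cutoff, indicator_of_mem (by exact hx), Pi.one_apply, sub_self, norm_zero]
    positivity
  · rw [cutoff, indicator_of_notMem (by exact hx), zero_sub, norm_neg, norm_one,
      le_div_iff₀ (by positivity)]
    linarith

theorem memLp_cutoff_mul_exp (t k : ℝ) :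
    MemLp (fun x : ℝ => cutoff t x * Complex.exp (↑(2 * Real.pi * x * k) * Complex.I)) 2
      volume := by
  have h : MemLp (cutoff t) 2 volume :=
    memLp_indicator_const 2 (measurableSet_sq_le t) (1 : ℂ) (Or.inr (volume_sq_le_ne_top t))
  refine h.congr_norm (h.1.mul (by fun_prop : Continuous _).aestronglyMeasurable)
    (Eventually.of_forall fun x => ?_)
  rw [norm_mul, Complex.norm_exp_ofReal_mul_I, mul_one]

/-- The Fourier integral at `k` over the range `x² ≤ t`: unlike the full Fourier integral, it is a
bounded functional on `L²`, and so passes through the Duhamel integral. -/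
def cutoffFourier (t k : ℝ) : L2 →L[ℂ] ℂ := innerSL ℂ ((memLp_cutoff_mul_exp t k).toLp _)

theorem cutoffFourier_apply (t k : ℝ) (f : L2) :
    cutoffFourier t k f = 𝓕 (fun x => cutoff t x * f x) k := by
  rw [cutoffFourier, innerSL_apply_apply, L2.inner_def, Real.fourier_real_eq_integral_exp_smul]
  refine integral_congr_ae ?_
  filter_upwards [(memLp_cutoff_mul_exp t k).coeFn_toLp] with x hx
  have hcutoff : (starRingEnd ℂ) (cutoff t x) = cutoff t x := by
    by_cases h : x ^ 2 ≤ t <;> simp [cutoff, h]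
  have hphase : (starRingEnd ℂ) (((2 * Real.pi * x * k : ℝ) : ℂ) * Complex.I) =
      ((-2 * Real.pi * x * k : ℝ) : ℂ) * Complex.I := by
    rw [map_mul, Complex.conj_I, Complex.conj_ofReal]
    push_cast
    ring
  rw [hx, RCLike.inner_apply, map_mul, ← Complex.exp_conj, hphase, hcutoff, smul_eq_mul]
  ring

theorem enorm_cutoffFourier_le (t k : ℝ) (f : L2) :
    ‖cutoffFourier t k f‖ₑ ≤ eLpNorm f 1 volume := by
  rw [cutoffFourier_apply]
  refine (enorm_fourier_le _ k).trans (eLpNorm_mono fun x => ?_)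
  rw [norm_mul]
  refine mul_le_of_le_one_left (norm_nonneg _) ?_
  exact (norm_indicator_le_norm_self _ x).trans_eq norm_one

theorem enorm_cutoffFourier_sub_le {f : L2} {t : ℝ} (ht : 0 < t) (hf : Integrable f) (k : ℝ) :
    ‖cutoffFourier t k f - 𝓕 (f : ℝ → ℂ) k‖ₑ ≤
      ENNReal.ofReal (3 * √Real.pi * t ^ (-1 / 4 : ℝ)) * normHdot01 f := by
  rw [cutoffFourier_apply]
  exact enorm_fourier_mul_sub_le ht
    (measurable_one.indicator (measurableSet_sq_le t)).aestronglyMeasurable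
    (norm_cutoff_sub_one_le ht) hf k

end FourierMultiplicationDecay

section CubicNonlinearity

variable {v w : L2} {M : ℝ}

theorem cubic_ae_eq (hM : ∀ᵐ x, ‖v x‖ ≤ M) : cubic v =ᵐ[volume] fun x => ‖v x‖ ^ 2 • v x := by
  have h : MemLp (fun x => ‖v x‖ ^ 2 • v x) 2 volume := memLp_cube (Lp.memLp v) hM
  rw [cubic, dif_pos h]
  exact h.coeFn_toLp

theorem integrable_cubic (hv : Integrable v) (hM : ∀ᵐ x, ‖v x‖ ≤ M) : Integrable (cubic v) :=
  (integrable_congr (cubic_ae_eq hM)).2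
    (memLp_one_iff_integrable.1 (memLp_cube (memLp_one_iff_integrable.2 hv) hM))

theorem normHdot10_cubic_le (hv : Integrable v) (hM : ∀ᵐ x, ‖v x‖ ≤ M) :
    normHdot10 (cubic v) ≤ ENNReal.ofReal (3 * M ^ 2) * normHdot10 v := by
  rw [normHdot10_eq_dotH1 (integrable_cubic hv hM), normHdot10_eq_dotH1 hv,
    dotH1_congr_ae (cubic_ae_eq hM)]
  exact dotH1_cube_le hv (Lp.memLp v) hM

theorem norm_cubic_sub_cubic_le (hv : ∀ᵐ x, ‖v x‖ ≤ M) (hw : ∀ᵐ x, ‖w x‖ ≤ M) :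
    ‖cubic v - cubic w‖ ≤ 3 * M ^ 2 * ‖v - w‖ := by
  refine Lp.norm_le_mul_norm_of_ae_le_mul ?_
  filter_upwards [cubic_ae_eq hv, cubic_ae_eq hw, hv, hw, Lp.coeFn_sub (cubic v) (cubic w),
    Lp.coeFn_sub v w] with x hcv hcw hvx hwx hsub_cubic hsub
  rw [hsub_cubic, hsub, Pi.sub_apply, Pi.sub_apply, hcv, hcw]
  exact norm_cube_sub_cube_le hvx hwx

theorem inner_cubic_im (hv : ∀ᵐ x, ‖v x‖ ≤ M) : (inner ℂ v (cubic v)).im = 0 := by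
  have hreal : inner ℂ v (cubic v) = ∫ x, ((‖v x‖ ^ 4 : ℝ) : ℂ) := by
    rw [L2.inner_def]
    refine integral_congr_ae ?_
    filter_upwards [cubic_ae_eq hv] with x hx
    rw [hx, inner_smul_right_eq_smul, RCLike.inner_apply, Complex.mul_conj', Complex.real_smul]
    push_cast
    ring
  rw [hreal, integral_complex_ofReal, Complex.ofReal_im]

theorem normHdot01_freeGroup_neg_le {s : ℝ} (hs : 0 < s) (hv : Integrable v) :
    normHdot01 (freeGroup (-s) v) ≤ ENNReal.ofReal s * normHdot10 v + normHdot01 v := by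
  have hs' : -s ≠ 0 := neg_ne_zero.2 hs.ne'
  rw [normHdot01_freeGroup hs' hv, abs_neg, abs_of_pos hs, normHdot10_eq_dotH1 hv]
  refine (mul_le_mul_right (dotH1_chirp_mul_le hs' hv (Lp.memLp v)) _).trans_eq ?_
  rw [abs_neg, abs_of_pos hs, mul_add, ← mul_assoc, ← ENNReal.ofReal_mul hs.le,
    mul_inv_cancel₀ hs.ne', ENNReal.ofReal_one, one_mul]
  rfl

theorem normHdot01_freeGroup_cubic_le {t : ℝ} (ht : t ≠ 0) (hv : Integrable v)
    (hM : ∀ᵐ x, ‖v x‖ ≤ M) :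
    normHdot01 (freeGroup t (cubic v)) ≤
      ENNReal.ofReal (3 * M ^ 2) * normHdot01 (freeGroup t v) := by
  rw [normHdot01_freeGroup ht (integrable_cubic hv hM), normHdot01_freeGroup ht hv,
    mul_left_comm]
  gcongr
  have hchirp : (fun y => chirp t y * cubic v y) =ᵐ[volume]
      fun y => ‖chirp t y * v y‖ ^ 2 • (chirp t y * v y) := by
    filter_upwards [cubic_ae_eq hM] with x hx
    rw [hx, norm_mul, norm_chirp, one_mul, mul_smul_comm]
  rw [dotH1_congr_ae hchirp]
  refine dotH1_cube_le (integrable_chirp_mul hv t) (memLp_chirp_mul (Lp.memLp v) t) ?_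
  filter_upwards [hM] with x hx
  rwa [norm_mul, norm_chirp, one_mul]

end CubicNonlinearity

section SelfSimilarVariables

/-- For `f = freeGroup (-s) v`, this is `v` in self-similar variables: up to a chirp and a factor of
modulus `(2πs)^(1/2)`, its value at `k` is `v (2πs k)`. -/
def chirpFourier (s : ℝ) (f : L2) : ℝ → ℂ := 𝓕 (fun x => chirp s x * f x)

theorem continuous_chirpFourier (s : ℝ) {f : L2} (hf : Integrable f) :
    Continuous (chirpFourier s f) :=
  continuous_fourier (integrable_chirp_mul hf s)

theorem enorm_chirpFourier_le (s : ℝ) (f : L2) (k : ℝ) :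
    ‖chirpFourier s f k‖ₑ ≤ eLpNorm f 1 volume :=
  (enorm_fourier_le _ k).trans_eq (eLpNorm_congr_norm_ae (Eventually.of_forall fun x => by
    rw [norm_mul, norm_chirp, one_mul]))

theorem enorm_chirpFourier_sub_fourier_le {f : L2} {s : ℝ} (hs : 0 < s) (hf : Integrable f)
    (k : ℝ) :
    ‖chirpFourier s f k - 𝓕 (f : ℝ → ℂ) k‖ₑ ≤
      ENNReal.ofReal (3 * √Real.pi * s ^ (-1 / 4 : ℝ)) * normHdot01 f :=
  enorm_fourier_mul_sub_le hs (continuous_chirp s).aestronglyMeasurable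
    (norm_chirp_sub_one_le hs) hf k

theorem ae_eq_chirpFourier {s : ℝ} (hs : s ≠ 0) {v : L2} (hf : Integrable (freeGroup (-s) v)) :
    v =ᵐ[volume] fun x => kernelConst s * chirp s x *
      chirpFourier s (freeGroup (-s) v) (x / (2 * Real.pi * s)) := by
  have h := freeGroup_ae_eq hs hf
  rwa [freeGroup_freeGroup, add_neg_cancel, freeGroup_zero] at h

theorem forall_of_ae_div {p : ℝ → Prop} (hp : IsClosed {k | p k}) {c : ℝ} (hc : c ≠ 0)
    (h : ∀ᵐ x, p (x / c)) (k : ℝ) : p k := by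
  have hdense : Dense {x | p (x / c)} := Measure.dense_of_ae h
  have hclosed : IsClosed {x | p (x / c)} := hp.preimage (continuous_id.div_const c)
  have hall := hclosed.closure_subset (hdense (k * c))
  rwa [mem_ofPred_eq, mul_div_cancel_right₀ _ hc] at hall

theorem one_div_sqrt_mul_sqrt_pi_le {s : ℝ} (hs : 0 < s) :
    1 / √(2 * Real.pi * s) * √Real.pi ≤ s ^ (-(1 / 2) : ℝ) := by
  calc 1 / √(2 * Real.pi * s) * √Real.pi ≤ 1 / √(Real.pi * s) * √Real.pi := by
        gcongr
        linarith [Real.pi_pos]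
    _ = s ^ (-(1 / 2) : ℝ) := by
        rw [Real.sqrt_mul Real.pi_pos.le, Real.rpow_neg hs.le, ← Real.sqrt_eq_rpow]
        field_simp

theorem ae_norm_le_of_chirpFourier {s : ℝ} (hs : 0 < s) {v : L2}
    (hf : Integrable (freeGroup (-s) v)) {B : ℝ}
    (hB : ∀ k, ‖chirpFourier s (freeGroup (-s) v) k‖ ≤ √Real.pi * B) :
    ∀ᵐ x, ‖v x‖ ≤ B * s ^ (-(1 / 2) : ℝ) := by
  have hB_nonneg : 0 ≤ B := nonneg_of_mul_nonneg_right ((norm_nonneg _).trans (hB 0))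
    (Real.sqrt_pos.2 Real.pi_pos)
  filter_upwards [ae_eq_chirpFourier hs.ne' hf] with x hx
  rw [hx, norm_mul, norm_mul, norm_chirp, mul_one, norm_kernelConst, abs_of_pos hs]
  calc 1 / √(2 * Real.pi * s) * ‖chirpFourier s (freeGroup (-s) v) (x / (2 * Real.pi * s))‖
      ≤ 1 / √(2 * Real.pi * s) * (√Real.pi * B) := by
        gcongr
        exact hB _
    _ ≤ s ^ (-(1 / 2) : ℝ) * B := by
        rw [← mul_assoc]
        gcongr
        exact one_div_sqrt_mul_sqrt_pi_le hs
    _ = B * s ^ (-(1 / 2) : ℝ) := mul_comm _ _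

theorem norm_chirpFourier_le {s : ℝ} (hs : 0 < s) {v : L2}
    (hf : Integrable (freeGroup (-s) v)) {M : ℝ} (hM : ∀ᵐ x, ‖v x‖ ≤ M) (k : ℝ) :
    ‖chirpFourier s (freeGroup (-s) v) k‖ ≤ √(2 * Real.pi * s) * M := by
  have hc : 0 < 2 * Real.pi * s := mul_pos Real.two_pi_pos hs
  refine forall_of_ae_div (isClosed_le (continuous_chirpFourier s hf).norm continuous_const)
    hc.ne' ?_ k
  filter_upwards [ae_eq_chirpFourier hs.ne' hf, hM] with x hx hx_le
  rw [hx, norm_mul, norm_mul, norm_chirp, mul_one, norm_kernelConst, abs_of_pos hs, one_div,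
    inv_mul_le_iff₀ (Real.sqrt_pos.2 hc)] at hx_le
  exact hx_le

theorem chirpFourier_cubic {s : ℝ} (hs : 0 < s) {v : L2} (hf : Integrable (freeGroup (-s) v))
    {M : ℝ} (hM : ∀ᵐ x, ‖v x‖ ≤ M) (hg : Integrable (freeGroup (-s) (cubic v))) (k : ℝ) :
    chirpFourier s (freeGroup (-s) (cubic v)) k =
      ((‖chirpFourier s (freeGroup (-s) v) k‖ ^ 2 / (2 * Real.pi * s) : ℝ) : ℂ) *
        chirpFourier s (freeGroup (-s) v) k := by
  have hc : 2 * Real.pi * s ≠ 0 := (mul_pos Real.two_pi_pos hs).ne'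
  have hw := continuous_chirpFourier s hf
  have hcont : Continuous fun k =>
      ((‖chirpFourier s (freeGroup (-s) v) k‖ ^ 2 / (2 * Real.pi * s) : ℝ) : ℂ) *
        chirpFourier s (freeGroup (-s) v) k := by
    fun_prop
  refine forall_of_ae_div (isClosed_eq (continuous_chirpFourier s hg) hcont) hc ?_ k
  filter_upwards [ae_eq_chirpFourier hs.ne' hf, ae_eq_chirpFourier hs.ne' hg, cubic_ae_eq hM]
    with x hv_eq hcubic_eq hcube
  have hne : kernelConst s * chirp s x ≠ 0 := by
    refine mul_ne_zero (norm_ne_zero_iff.1 ?_) (norm_ne_zero_iff.1 ?_)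
    · rw [norm_kernelConst, abs_of_pos hs]
      exact (one_div_pos.2 (Real.sqrt_pos.2 (mul_pos Real.two_pi_pos hs))).ne'
    · rw [norm_chirp]
      exact one_ne_zero
  refine mul_left_cancel₀ hne ?_
  rw [← hcubic_eq, hcube, hv_eq, norm_mul, norm_mul, norm_chirp, mul_one, mul_pow,
    norm_kernelConst_sq, abs_of_pos hs, Complex.real_smul, one_div_mul_eq_div]
  ring

end SelfSimilarVariables

section DuhamelIdentity

theorem hasDerivAt_integral_of_continuousOn {E : Type*} [NormedAddCommGroup E] [NormedSpace ℝ E]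
    [CompleteSpace E] {b : ℝ → E} {t₀ t₁ s : ℝ} (hb : ContinuousOn b (Icc t₀ t₁))
    (hs : s ∈ Ioo t₀ t₁) : HasDerivAt (fun τ => ∫ σ in t₀..τ, b σ) (b s) s := by
  refine intervalIntegral.integral_hasDerivAt_right ?_ ?_ ?_
  · refine (hb.mono ?_).intervalIntegrable
    rw [uIcc_of_le hs.1.le]
    exact Icc_subset_Icc_right hs.2.le
  · exact (hb.mono Ioo_subset_Icc_self).stronglyMeasurableAtFilter isOpen_Ioo s hs
  · exact hb.continuousAt (Icc_mem_nhds hs.1 hs.2)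

theorem continuousOn_integral_of_continuousOn {E : Type*} [NormedAddCommGroup E] [NormedSpace ℝ E]
    {b : ℝ → E} {t₀ t₁ : ℝ} (h : t₀ ≤ t₁) (hb : ContinuousOn b (Icc t₀ t₁)) :
    ContinuousOn (fun τ => ∫ σ in t₀..τ, b σ) (Icc t₀ t₁) := by
  rw [← uIcc_of_le h] at hb ⊢
  exact intervalIntegral.continuousOn_primitive_interval hb.integrableOn_uIcc

section RealDerivative

variable {E : Type*} [NormedAddCommGroup E] [InnerProductSpace ℝ E] {a a' : ℝ → E} {e : ℝ → ℝ}
  {t₀ t : ℝ}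

theorem sqrt_norm_sq_add_sq_le {δ : ℝ} (ht : t₀ ≤ t) (hδ : 0 < δ) (ha : ContinuousOn a (Icc t₀ t))
    (ha' : ContinuousOn a' (Icc t₀ t)) (hderiv : ∀ s ∈ Ioo t₀ t, HasDerivAt a (a' s) s)
    (he : IntervalIntegrable e volume t₀ t)
    (h : ∀ᵐ s ∂volume.restrict (Icc t₀ t), 0 ≤ e s ∧ inner ℝ (a s) (a' s) ≤ ‖a s‖ * e s) :
    √(‖a t‖ ^ 2 + δ ^ 2) ≤ √(‖a t₀‖ ^ 2 + δ ^ 2) + ∫ s in t₀..t, e s := by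
  have hpos : ∀ s, 0 < ‖a s‖ ^ 2 + δ ^ 2 := fun s => by positivity
  have hsqrt_pos : ∀ s, 0 < √(‖a s‖ ^ 2 + δ ^ 2) := fun s => Real.sqrt_pos.2 (hpos s)
  have hcont : ContinuousOn (fun s => √(‖a s‖ ^ 2 + δ ^ 2)) (Icc t₀ t) :=
    ((ha.norm.pow 2).add continuousOn_const).sqrt
  have hcont_deriv : ContinuousOn
      (fun s => 2 * inner ℝ (a s) (a' s) / (2 * √(‖a s‖ ^ 2 + δ ^ 2))) (uIcc t₀ t) := by
    rw [uIcc_of_le ht]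
    exact (continuousOn_const.mul (ha.inner ha')).div (continuousOn_const.mul hcont)
      fun s _ => (mul_pos two_pos (hsqrt_pos s)).ne'
  have hftc := intervalIntegral.integral_eq_sub_of_hasDerivAt_of_le ht hcont
    (fun s hs => ((hderiv s hs).norm_sq.add_const (δ ^ 2)).sqrt (hpos s).ne')
    hcont_deriv.intervalIntegrable
  rw [← sub_le_iff_le_add', ← hftc]
  refine intervalIntegral.integral_mono_ae_restrict ht hcont_deriv.intervalIntegrable he ?_
  filter_upwards [h] with s ⟨he_nonneg, hinner⟩
  rw [mul_div_mul_left _ _ two_ne_zero, div_le_iff₀ (hsqrt_pos s), mul_comm]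
  refine hinner.trans (mul_le_mul_of_nonneg_right (Real.le_sqrt_of_sq_le ?_) he_nonneg)
  exact le_add_of_nonneg_right (sq_nonneg δ)

theorem norm_le_add_integral_of_inner_deriv_le (ht : t₀ ≤ t) (ha : ContinuousOn a (Icc t₀ t))
    (ha' : ContinuousOn a' (Icc t₀ t)) (hderiv : ∀ s ∈ Ioo t₀ t, HasDerivAt a (a' s) s)
    (he : IntervalIntegrable e volume t₀ t)
    (h : ∀ᵐ s ∂volume.restrict (Icc t₀ t), 0 ≤ e s ∧ inner ℝ (a s) (a' s) ≤ ‖a s‖ * e s) :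
    ‖a t‖ ≤ ‖a t₀‖ + ∫ s in t₀..t, e s := by
  refine le_of_forall_pos_le_add fun δ hδ => ?_
  have hle : ‖a t‖ ≤ √(‖a t‖ ^ 2 + δ ^ 2) :=
    Real.le_sqrt_of_sq_le (le_add_of_nonneg_right (sq_nonneg δ))
  have hge : √(‖a t₀‖ ^ 2 + δ ^ 2) ≤ ‖a t₀‖ + δ :=
    Real.sqrt_le_iff.2 ⟨by positivity, by nlinarith [norm_nonneg (a t₀)]⟩
  linarith [sqrt_norm_sq_add_sq_le ht hδ ha ha' hderiv he h]

end RealDerivative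

variable {E : Type*} [NormedAddCommGroup E] [InnerProductSpace ℂ E]

theorem re_inner_neg_I_smul (v w : E) :
    (inner ℂ v (-(Complex.I • w))).re = (inner ℂ v w).im := by
  rw [inner_neg_right, inner_smul_right, Complex.neg_re, Complex.I_mul_re, neg_neg]

theorem inner_im_le_of_norm_sub_smul_le {v w : E} {r e : ℝ} (h : ‖w - (r : ℂ) • v‖ ≤ e) :
    (inner ℂ v w).im ≤ ‖v‖ * e := by
  have him : (inner ℂ v w).im = (inner ℂ v (w - (r : ℂ) • v)).im := by
    rw [inner_sub_right, inner_smul_right, inner_self_eq_norm_sq_to_K, Complex.sub_im,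
      Complex.im_ofReal_mul]
    simp [← Complex.ofReal_pow]
  calc (inner ℂ v w).im ≤ ‖inner ℂ v (w - (r : ℂ) • v)‖ := him ▸ Complex.im_le_norm _
    _ ≤ ‖v‖ * ‖w - (r : ℂ) • v‖ := norm_inner_le_norm _ _
    _ ≤ ‖v‖ * e := by gcongr

theorem norm_le_add_integral_of_duhamel [CompleteSpace E] {a b : ℝ → E} {a₀ : E} {e : ℝ → ℝ}
    {t₀ t : ℝ} (ht : t₀ ≤ t) (hb : ContinuousOn b (Icc t₀ t))
    (ha : ∀ τ ∈ Icc t₀ t, a τ = a₀ - Complex.I • ∫ s in t₀..τ, b s)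
    (he : IntervalIntegrable e volume t₀ t)
    (h : ∀ᵐ s ∂volume.restrict (Icc t₀ t), 0 ≤ e s ∧ (inner ℂ (a s) (b s)).im ≤ ‖a s‖ * e s) :
    ‖a t‖ ≤ ‖a₀‖ + ∫ s in t₀..t, e s := by
  have hstart : a t₀ = a₀ := by
    rw [ha t₀ (left_mem_Icc.2 ht), intervalIntegral.integral_same, smul_zero, sub_zero]
  have hcont : ContinuousOn a (Icc t₀ t) :=
    (continuousOn_const.sub
      ((continuousOn_integral_of_continuousOn ht hb).const_smul Complex.I)).congr ha
  have hderiv : ∀ s ∈ Ioo t₀ t, HasDerivAt a (-(Complex.I • b s)) s := fun s hs => by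
    refine (((hasDerivAt_integral_of_continuousOn hb hs).const_smul Complex.I).const_sub
      a₀).congr_of_eventuallyEq ?_
    filter_upwards [Icc_mem_nhds hs.1 hs.2] with τ hτ using ha τ hτ
  let : InnerProductSpace ℝ E := InnerProductSpace.complexToReal
  rw [← hstart]
  refine norm_le_add_integral_of_inner_deriv_le ht hcont (hb.const_smul Complex.I).neg hderiv he ?_
  filter_upwards [h] with s hs
  exact ⟨hs.1, (re_inner_neg_I_smul (a s) (b s)).trans_le hs.2⟩

end DuhamelIdentity

section ContinuousTrajectories

theorem exists_forall_le_of_isCompact {X G : Type*} [TopologicalSpace X] [AddGroup G] {K : Set X}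
    (hK : IsCompact K) {N : G → ℝ≥0∞} (hN : ∀ f g, N (f + g) ≤ N f + N g) {u : X → G}
    (hfin : ∀ t ∈ K, N (u t) ≠ ∞)
    (hu : ∀ t₀ ∈ K, Tendsto (fun t => N (u t - u t₀)) (𝓝[K] t₀) (𝓝 0)) :
    ∃ B : ℝ≥0, ∀ t ∈ K, N (u t) ≤ B := by
  refine hK.induction_on (p := fun S => ∃ B : ℝ≥0, ∀ t ∈ S, N (u t) ≤ B) ⟨0, by simp⟩ ?_ ?_ ?_
  · rintro S S' hS ⟨B, hB⟩
    exact ⟨B, fun t ht => hB t (hS ht)⟩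
  · rintro S S' ⟨B, hB⟩ ⟨B', hB'⟩
    refine ⟨max B B', fun t ht => ?_⟩
    rw [ENNReal.coe_max]
    exact ht.elim (fun h => le_max_of_le_left (hB t h)) fun h => le_max_of_le_right (hB' t h)
  · intro t₀ ht₀
    refine ⟨_, (hu t₀ ht₀).eventually (gt_mem_nhds one_pos), (1 + N (u t₀)).toNNReal,
      fun t ht => ?_⟩
    rw [ENNReal.coe_toNNReal (ENNReal.add_ne_top.2 ⟨ENNReal.one_ne_top, hfin t₀ ht₀⟩)]
    calc N (u t) = N (u t - u t₀ + u t₀) := by rw [sub_add_cancel]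
      _ ≤ N (u t - u t₀) + N (u t₀) := hN _ _
      _ ≤ 1 + N (u t₀) := by
        gcongr
        exact le_of_lt ht

theorem norm_le_of_enorm_le_eLpNorm_one {z : ℂ} {g : L2} {B : ℝ} (hB : 0 ≤ B)
    (hg : normH01 g ≤ ENNReal.ofReal B) (hz : ‖z‖ₑ ≤ eLpNorm g 1 volume) :
    ‖z‖ ≤ √Real.pi * B := by
  have hz_le : ‖z‖ₑ ≤ ENNReal.ofReal (√Real.pi * B) := by
    rw [ENNReal.ofReal_mul (Real.sqrt_nonneg _)]
    exact hz.trans ((eLpNorm_one_le_normH01 g).trans (by gcongr))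
  exact toReal_enorm z ▸ ENNReal.toReal_le_of_le_ofReal (by positivity) hz_le

namespace ContinuousIntoH

variable {T t : ℝ} {u : ℝ → L2}

theorem exists_norm_le (hu : ContinuousIntoH T u) :
    ∃ K : ℝ≥0, ∀ t ∈ Icc 1 T, normH10 (u t) + normH01 (u t) ≤ K :=
  exists_forall_le_of_isCompact (N := fun g => normH10 g + normH01 g) isCompact_Icc
    (fun f g => (add_le_add (normH10_add_le f g) (normH01_add_le f g)).trans_eq
      (add_add_add_comm _ _ _ _))
    (fun t ht => (ENNReal.add_lt_top.2 (hu.1 t ht)).ne) hu.2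

theorem continuousOn (hu : ContinuousIntoH T u) : ContinuousOn u (Icc 1 T) := by
  intro t₀ ht₀
  rw [ContinuousWithinAt, tendsto_iff_edist_tendsto_0]
  refine tendsto_of_tendsto_of_tendsto_of_le_of_le tendsto_const_nhds (hu.2 t₀ ht₀)
    (fun _ => zero_le) fun t => ?_
  rw [edist_eq_enorm_sub]
  exact (enorm_le_normH01 _).trans le_add_self

theorem integrable (hu : ContinuousIntoH T u) (ht : t ∈ Icc 1 T) : Integrable (u t) :=
  integrable_of_normH01_ne_top (hu.1 t ht).2.ne

theorem exists_normH01_profile_le (hu : ContinuousIntoH T u) :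
    ∃ K : ℝ≥0, ∀ t ∈ Icc 1 T, normH01 (profile u t) ≤ K := by
  obtain ⟨K, hK⟩ := hu.exists_norm_le
  refine ⟨K + (T.toNNReal * K + K), fun t ht => ?_⟩
  have h10 : normHdot10 (u t) ≤ K :=
    (normHdot10_le_normH10 _).trans (le_self_add.trans (hK t ht))
  have h01 : normH01 (u t) ≤ K := le_add_self.trans (hK t ht)
  have hprofile : ‖profile u t‖ₑ = ‖u t‖ₑ := (freeGroupIsometry (-t)).enorm_map (u t)
  calc normH01 (profile u t) ≤ ‖u t‖ₑ + normHdot01 (profile u t) := hprofile ▸ normH01_le _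
    _ ≤ ‖u t‖ₑ + (ENNReal.ofReal t * normHdot10 (u t) + normHdot01 (u t)) := by
      gcongr
      exact normHdot01_freeGroup_neg_le (one_pos.trans_le ht.1) (hu.integrable ht)
    _ ≤ K + (ENNReal.ofReal T * K + K) := by
      gcongr
      exacts [(enorm_le_normH01 _).trans h01, ht.2, (normHdot01_le_normH01 _).trans h01]
    _ = (K + (T.toNNReal * K + K) : ℝ≥0) := by
      push_cast
      rfl

theorem integrable_profile (hu : ContinuousIntoH T u) (ht : t ∈ Icc 1 T) :
    Integrable (profile u t) := by
  obtain ⟨K, hK⟩ := hu.exists_normH01_profile_le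
  exact integrable_of_normH01_ne_top ((hK t ht).trans_lt ENNReal.coe_lt_top).ne

theorem exists_sup_le (hu : ContinuousIntoH T u) :
    ∃ K : ℝ≥0, ∀ t ∈ Icc 1 T, ∀ᵐ x, ‖u t x‖ ≤ K := by
  obtain ⟨K, hK⟩ := hu.exists_normH01_profile_le
  refine ⟨K, fun t ht => ?_⟩
  have hchirp : ∀ k, ‖chirpFourier t (profile u t) k‖ ≤ √Real.pi * K := fun k =>
    norm_le_of_enorm_le_eLpNorm_one K.2 ((hK t ht).trans_eq ENNReal.ofReal_coe_nnreal.symm)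
      (enorm_chirpFourier_le t _ k)
  filter_upwards [ae_norm_le_of_chirpFourier (one_pos.trans_le ht.1)
    (hu.integrable_profile ht) hchirp] with x hx
  exact hx.trans (mul_le_of_le_one_right K.2
    (Real.rpow_le_one_of_one_le_of_nonpos ht.1 (by norm_num)))

theorem continuousOn_cubic (hu : ContinuousIntoH T u) :
    ContinuousOn (fun s => cubic (u s)) (Icc 1 T) := by
  obtain ⟨K, hK⟩ := hu.exists_sup_le
  have hlip : LipschitzOnWith (3 * K ^ 2) cubic (u '' Icc 1 T) := by
    refine LipschitzOnWith.of_dist_le_mul ?_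
    rintro _ ⟨s, hs, rfl⟩ _ ⟨s', hs', rfl⟩
    rw [dist_eq_norm, dist_eq_norm]
    exact norm_cubic_sub_cubic_le (hK s hs) (hK s' hs')
  exact hlip.continuousOn.comp hu.continuousOn (mapsTo_image u _)

end ContinuousIntoH

end ContinuousTrajectories

section SpaceTimeNorm

variable {T β y : ℝ} {φ : ℝ → ℝ≥0∞}

theorem supTime_le {B : ℝ≥0∞} (h : ∀ t ∈ Icc 1 T, φ t ≤ B) : supTime T φ ≤ B :=
  essSup_le_of_ae_le B (ae_restrict_of_forall_mem measurableSet_Icc h)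

theorem supTime_rpow_mul_lt_top {K : ℝ≥0} (h : ∀ t ∈ Icc 1 T, φ t ≤ K) :
    supTime T (fun t => ENNReal.ofReal (t ^ β) * φ t) < ∞ := by
  have hle : supTime T (fun t => ENNReal.ofReal (t ^ β) * φ t) ≤ ENNReal.ofReal (T ^ |β|) * K := by
    refine supTime_le fun t ht => mul_le_mul' (ENNReal.ofReal_le_ofReal ?_) (h t ht)
    exact (Real.rpow_le_rpow_of_exponent_le ht.1 (le_abs_self β)).trans
      (Real.rpow_le_rpow (zero_le_one.trans ht.1) ht.2 (abs_nonneg β))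
  exact hle.trans_lt (ENNReal.mul_lt_top ENNReal.ofReal_lt_top ENNReal.coe_lt_top)

theorem ofReal_rpow_mul_ofReal_rpow_neg {t : ℝ} (ht : 0 < t) (β : ℝ) :
    ENNReal.ofReal (t ^ β) * ENNReal.ofReal (t ^ (-β)) = 1 := by
  rw [← ENNReal.ofReal_mul (by positivity), ← Real.rpow_add ht, add_neg_cancel, Real.rpow_zero,
    ENNReal.ofReal_one]

theorem supTime_rpow_mul_le (h : ∀ t ∈ Icc 1 T, φ t ≤ ENNReal.ofReal (y * t ^ (-β))) :
    supTime T (fun t => ENNReal.ofReal (t ^ β) * φ t) ≤ ENNReal.ofReal y := by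
  refine supTime_le fun t ht => ?_
  have ht_pos : 0 < t := one_pos.trans_le ht.1
  calc ENNReal.ofReal (t ^ β) * φ t
      ≤ ENNReal.ofReal (t ^ β) * ENNReal.ofReal (y * t ^ (-β)) := by
        gcongr
        exact h t ht
    _ = ENNReal.ofReal y := by
        rw [ENNReal.ofReal_mul' (by positivity), mul_left_comm,
          ofReal_rpow_mul_ofReal_rpow_neg ht_pos, mul_one]

theorem ae_le_of_supTime_rpow_mul_le
    (h : supTime T (fun t => ENNReal.ofReal (t ^ β) * φ t) ≤ ENNReal.ofReal y) :
    ∀ᵐ t ∂volume.restrict (Icc 1 T), φ t ≤ ENNReal.ofReal (y * t ^ (-β)) := by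
  filter_upwards [ENNReal.ae_le_essSup fun t => ENNReal.ofReal (t ^ β) * φ t,
    ae_restrict_mem measurableSet_Icc] with t hle ht
  have ht_pos : 0 < t := one_pos.trans_le ht.1
  calc φ t = ENNReal.ofReal (t ^ (-β)) * (ENNReal.ofReal (t ^ β) * φ t) := by
        rw [← mul_assoc, mul_comm (ENNReal.ofReal _), ofReal_rpow_mul_ofReal_rpow_neg ht_pos,
          one_mul]
    _ ≤ ENNReal.ofReal (t ^ (-β)) * ENNReal.ofReal y := by
        gcongr
        exact hle.trans h
    _ = ENNReal.ofReal (y * t ^ (-β)) := by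
        rw [ENNReal.ofReal_mul' (by positivity), mul_comm]

theorem eLpNorm_top_le_ofReal {g : ℝ → ℂ} {M : ℝ} (h : ∀ᵐ x, ‖g x‖ ≤ M) :
    eLpNorm g ∞ volume ≤ ENNReal.ofReal M := by
  rw [eLpNorm_exponent_top]
  exact eLpNormEssSup_le_of_ae_bound h

theorem ae_norm_le_of_eLpNorm_top_le {g : ℝ → ℂ} {M : ℝ} (hM : 0 ≤ M)
    (h : eLpNorm g ∞ volume ≤ ENNReal.ofReal M) : ∀ᵐ x, ‖g x‖ ≤ M := by
  filter_upwards [enorm_ae_le_eLpNormEssSup g volume] with x hx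
  rw [eLpNorm_exponent_top] at h
  exact toReal_enorm (g x) ▸ ENNReal.toReal_le_of_le_ofReal hM (hx.trans h)

variable {α x : ℝ} {u : ℝ → L2}

theorem normX_lt_top (α : ℝ) (hu : ContinuousIntoH T u) : normX α T u < ∞ := by
  obtain ⟨K, hK⟩ := hu.exists_norm_le
  obtain ⟨L, hL⟩ := hu.exists_normH01_profile_le
  obtain ⟨M, hM⟩ := hu.exists_sup_le
  have hsup : ∀ t ∈ Icc 1 T, eLpNorm (u t) ∞ volume ≤ M := fun t ht =>
    (eLpNorm_top_le_ofReal (hM t ht)).trans_eq ENNReal.ofReal_coe_nnreal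
  have hdot10 : ∀ t ∈ Icc 1 T, normHdot10 (u t) ≤ K := fun t ht =>
    (normHdot10_le_normH10 _).trans (le_self_add.trans (hK t ht))
  have hdot01 : ∀ t ∈ Icc 1 T, normHdot01 (profile u t) ≤ L := fun t ht =>
    (normHdot01_le_normH01 _).trans (hL t ht)
  have hmass : ∀ t ∈ Icc 1 T, eLpNorm (u t) 2 volume ≤ K := fun t ht =>
    (Lp.enorm_def (u t)).symm.trans_le
      ((enorm_le_normH01 _).trans (le_add_self.trans (hK t ht)))
  exact ENNReal.add_lt_top.2 ⟨ENNReal.add_lt_top.2 ⟨ENNReal.add_lt_top.2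
    ⟨supTime_rpow_mul_lt_top hsup, supTime_rpow_mul_lt_top hdot10⟩,
      supTime_rpow_mul_lt_top hdot01⟩, (supTime_le hmass).trans_lt ENNReal.coe_lt_top⟩

theorem ae_bounds_of_normX_le (hx : 0 ≤ x) (h : normX α T u ≤ ENNReal.ofReal x) :
    ∀ᵐ s ∂volume.restrict (Icc 1 T), (∀ᵐ y, ‖u s y‖ ≤ x * s ^ (-(1 / 2) : ℝ)) ∧
      normHdot10 (u s) ≤ ENNReal.ofReal (x * s ^ α) ∧
      normHdot01 (profile u s) ≤ ENNReal.ofReal (x * s ^ α) := by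
  have hthree := le_self_add.trans h
  have htwo := le_self_add.trans hthree
  filter_upwards [ae_le_of_supTime_rpow_mul_le (le_self_add.trans htwo),
    ae_le_of_supTime_rpow_mul_le (le_add_self.trans htwo),
    ae_le_of_supTime_rpow_mul_le (le_add_self.trans hthree),
    ae_restrict_mem measurableSet_Icc] with s hsup hdot10 hdot01 hs
  rw [neg_neg] at hdot10 hdot01
  have hs_nonneg : 0 ≤ s := zero_le_one.trans hs.1
  exact ⟨ae_norm_le_of_eLpNorm_top_le (by positivity) hsup, hdot10, hdot01⟩

end SpaceTimeNorm

section Solutions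

/-- The nonlinearity pulled back by the free group, which is the integrand of Duhamel's formula for
the profile. -/
def pulledCubic (u : ℝ → L2) (s : ℝ) : L2 := freeGroup (-s) (cubic (u s))

variable {α T t x ε : ℝ} {uStar : L2} {u : ℝ → L2}

theorem ContinuousIntoH.continuousOn_pulledCubic (hu : ContinuousIntoH T u) (ht : t ≤ T) :
    ContinuousOn (pulledCubic u) (Icc 1 t) :=
  (continuousOn_freeGroup_comp continuousOn_neg hu.continuousOn_cubic).mono
    (Icc_subset_Icc_right ht)

theorem IsSolution.profile_eq (hu : IsSolution T uStar u) (ht : t ∈ Icc 1 T) :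
    profile u t = uStar - Complex.I • ∫ s in (1 : ℝ)..t, pulledCubic u s := by
  have hint : IntervalIntegrable (fun s => freeGroup (t - s) (cubic (u s))) volume 1 t := by
    refine (ContinuousOn.mono (continuousOn_freeGroup_comp (continuousOn_const.sub continuousOn_id)
      hu.continuous.continuousOn_cubic) ?_).intervalIntegrable
    rw [uIcc_of_le ht.1]
    exact Icc_subset_Icc_right ht.2
  have hcomm := (freeGroupIsometry (-t)).toContinuousLinearMap.intervalIntegral_comp_comm hint
  simp only [LinearIsometry.coe_toContinuousLinearMap, freeGroupIsometry_apply,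
    freeGroup_freeGroup, neg_add_eq_sub, sub_sub_cancel_left] at hcomm
  change freeGroupIsometry (-t) (u t) = _
  rw [hu.duhamel t ht, map_sub, map_smul, freeGroupIsometry_apply, freeGroupIsometry_apply,
    freeGroup_freeGroup, neg_add_cancel, freeGroup_zero, ← hcomm]
  rfl

theorem IsSolution.norm_le (hu : IsSolution T uStar u) (ht : t ∈ Icc 1 T) : ‖u t‖ ≤ ‖uStar‖ := by
  obtain ⟨K, hK⟩ := hu.continuous.exists_sup_le
  have hinner : ∀ᵐ s ∂volume.restrict (Icc 1 t), (0 : ℝ) ≤ 0 ∧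
      (inner ℂ (profile u s) (pulledCubic u s)).im ≤ ‖profile u s‖ * 0 := by
    refine ae_restrict_of_forall_mem measurableSet_Icc fun s hs => ⟨le_rfl, ?_⟩
    have hinv : inner ℂ (profile u s) (pulledCubic u s) = inner ℂ (u s) (cubic (u s)) :=
      (freeGroupIsometry (-s)).inner_map_map _ _
    rw [hinv, inner_cubic_im (hK s ⟨hs.1, hs.2.trans ht.2⟩), mul_zero]
  have h := norm_le_add_integral_of_duhamel ht.1 (hu.continuous.continuousOn_pulledCubic ht.2)
    (fun τ hτ => hu.profile_eq ⟨hτ.1, hτ.2.trans ht.2⟩) intervalIntegrable_const hinner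
  rwa [intervalIntegral.integral_zero, add_zero, profile, norm_freeGroup] at h

theorem lintegral_rpow_le {c : ℝ} (hα : 0 < α) (hc : 0 ≤ c) (ht : 1 ≤ t) :
    ∫⁻ s in Ioc 1 t, ENNReal.ofReal (c * s ^ (α - 1)) ≤ ENNReal.ofReal (c / α * t ^ α) := by
  have hint : IntervalIntegrable (fun s : ℝ => c * s ^ (α - 1)) volume 1 t :=
    (intervalIntegral.intervalIntegrable_rpow' (by linarith)).const_mul c
  rw [← ofReal_integral_eq_lintegral_ofReal hint.1
    (ae_restrict_of_forall_mem measurableSet_Ioc fun s hs =>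
      mul_nonneg hc (Real.rpow_nonneg (zero_le_one.trans hs.1.le) _)),
    ← intervalIntegral.integral_of_le ht, intervalIntegral.integral_const_mul,
    integral_rpow (Or.inl (by linarith)), sub_add_cancel, Real.one_rpow, mul_div_assoc',
    div_mul_eq_mul_div]
  gcongr
  exact sub_le_self _ zero_le_one

theorem mul_rpow_neg_half_sq {s : ℝ} (hs : 0 ≤ s) (x : ℝ) :
    (x * s ^ (-(1 / 2) : ℝ)) ^ 2 = x ^ 2 * s ^ (-1 : ℝ) := by
  rw [mul_pow, ← Real.rpow_mul_natCast hs]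
  norm_num

theorem ae_normHdot_pulledCubic_le (hx : 0 ≤ x) (hu : ContinuousIntoH T u)
    (hX : normX α T u ≤ ENNReal.ofReal x) :
    ∀ᵐ s ∂volume.restrict (Icc 1 T),
      normHdot10 (pulledCubic u s) ≤ ENNReal.ofReal (3 * x ^ 3 * s ^ (α - 1)) ∧
      normHdot01 (pulledCubic u s) ≤ ENNReal.ofReal (3 * x ^ 3 * s ^ (α - 1)) := by
  filter_upwards [ae_bounds_of_normX_le hx hX, ae_restrict_mem measurableSet_Icc]
    with s ⟨hsup, hdot10, hdot01⟩ hs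
  have hs_pos : 0 < s := one_pos.trans_le hs.1
  have hrate : 3 * x ^ 3 * s ^ (α - 1) = 3 * (x * s ^ (-(1 / 2) : ℝ)) ^ 2 * (x * s ^ α) := by
    rw [mul_rpow_neg_half_sq hs_pos.le, sub_eq_neg_add, Real.rpow_add hs_pos]
    ring
  rw [hrate, ENNReal.ofReal_mul (by positivity)]
  refine ⟨?_, ?_⟩
  · rw [pulledCubic, normHdot10_freeGroup]
    exact (normHdot10_cubic_le (hu.integrable hs) hsup).trans (by gcongr)
  · exact (normHdot01_freeGroup_cubic_le (neg_ne_zero.2 hs_pos.ne') (hu.integrable hs)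
      hsup).trans (mul_le_mul_right hdot01 _)

theorem IsSolution.le_add_lintegral (hu : IsSolution T uStar u) (ht : t ∈ Icc 1 T)
    {N : L2 → ℝ≥0∞} (hN_add : ∀ f g, N (f + g) ≤ N f + N g)
    (hN_smul : ∀ (c : ℂ) g, N (c • g) = ‖c‖ₑ * N g)
    (hN_integral : ∀ {ν : Measure ℝ} {F : ℝ → L2}, Integrable F ν →
      N (∫ s, F s ∂ν) ≤ ∫⁻ s, N (F s) ∂ν) :
    N (profile u t) ≤ N uStar + ∫⁻ s in Ioc 1 t, N (pulledCubic u s) := by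
  have hI : ‖-Complex.I‖ₑ = 1 := by
    rw [enorm_neg, ← ofReal_norm, Complex.norm_I, ENNReal.ofReal_one]
  have hint : IntegrableOn (pulledCubic u) (Ioc 1 t) :=
    (hu.continuous.continuousOn_pulledCubic ht.2).integrableOn_Icc.mono_set Ioc_subset_Icc_self
  rw [hu.profile_eq ht, sub_eq_add_neg, ← neg_smul, intervalIntegral.integral_of_le ht.1]
  refine (hN_add _ _).trans ?_
  rw [hN_smul, hI, one_mul]
  gcongr
  exact hN_integral hint

theorem IsSolution.growth (hu : IsSolution T uStar u) (hα : 0 < α) (hx : 0 ≤ x) (hε : 0 ≤ ε)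
    (ht : t ∈ Icc 1 T) {N : L2 → ℝ≥0∞} (hN_add : ∀ f g, N (f + g) ≤ N f + N g)
    (hN_smul : ∀ (c : ℂ) g, N (c • g) = ‖c‖ₑ * N g)
    (hN_integral : ∀ {ν : Measure ℝ} {F : ℝ → L2}, Integrable F ν →
      N (∫ s, F s ∂ν) ≤ ∫⁻ s, N (F s) ∂ν)
    (hN_star : N uStar ≤ ENNReal.ofReal ε)
    (hN_cubic : ∀ᵐ s ∂volume.restrict (Icc 1 T),
      N (pulledCubic u s) ≤ ENNReal.ofReal (3 * x ^ 3 * s ^ (α - 1))) :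
    N (profile u t) ≤ ENNReal.ofReal ((ε + 3 * x ^ 3 / α) * t ^ α) := by
  have ht_nonneg : 0 ≤ t := zero_le_one.trans ht.1
  have hsubset : Ioc 1 t ⊆ Icc 1 T := fun s hs => ⟨hs.1.le, hs.2.trans ht.2⟩
  calc N (profile u t) ≤ N uStar + ∫⁻ s in Ioc 1 t, N (pulledCubic u s) :=
        hu.le_add_lintegral ht hN_add hN_smul hN_integral
    _ ≤ ENNReal.ofReal ε + ∫⁻ s in Ioc 1 t, ENNReal.ofReal (3 * x ^ 3 * s ^ (α - 1)) :=
        add_le_add hN_star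
          (lintegral_mono_ae (ae_mono (Measure.restrict_mono hsubset le_rfl) hN_cubic))
    _ ≤ ENNReal.ofReal (ε * t ^ α) + ENNReal.ofReal (3 * x ^ 3 / α * t ^ α) :=
        add_le_add (ENNReal.ofReal_le_ofReal
          (le_mul_of_one_le_right hε (Real.one_le_rpow ht.1 hα.le)))
          (lintegral_rpow_le hα (by positivity) ht.1)
    _ = ENNReal.ofReal ((ε + 3 * x ^ 3 / α) * t ^ α) := by
        rw [← ENNReal.ofReal_add (by positivity) (by positivity), add_mul]

theorem IsSolution.normHdot10_le (hu : IsSolution T uStar u) (hα : 0 < α) (hx : 0 ≤ x)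
    (hε : 0 ≤ ε) (hX : normX α T u ≤ ENNReal.ofReal x) (hstar : normHdot10 uStar ≤ ENNReal.ofReal ε)
    (ht : t ∈ Icc 1 T) : normHdot10 (u t) ≤ ENNReal.ofReal ((ε + 3 * x ^ 3 / α) * t ^ α) := by
  rw [← normHdot10_freeGroup (-t)]
  exact hu.growth hα hx hε ht normHdot10_add_le normHdot10_smul normHdot10_integral_le hstar
    ((ae_normHdot_pulledCubic_le hx hu.continuous hX).mono fun _ h => h.1)

theorem IsSolution.normHdot01_profile_le (hu : IsSolution T uStar u) (hα : 0 < α) (hx : 0 ≤ x)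
    (hε : 0 ≤ ε) (hX : normX α T u ≤ ENNReal.ofReal x) (hstar : normHdot01 uStar ≤ ENNReal.ofReal ε)
    (ht : t ∈ Icc 1 T) :
    normHdot01 (profile u t) ≤ ENNReal.ofReal ((ε + 3 * x ^ 3 / α) * t ^ α) :=
  hu.growth hα hx hε ht normHdot01_add_le normHdot01_smul normHdot01_integral_le hstar
    ((ae_normHdot_pulledCubic_le hx hu.continuous hX).mono fun _ h => h.2)

end Solutions

section DispersiveDecay

theorem norm_cutoffFourier_sub_chirpFourier_le {f : L2} {s t A : ℝ} (hs : 0 < s) (hst : s ≤ t)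
    (hA : 0 ≤ A) (hf : normHdot01 f ≤ ENNReal.ofReal A) (k : ℝ) :
    ‖cutoffFourier t k f - chirpFourier s f k‖ ≤ 6 * √Real.pi * s ^ (-1 / 4 : ℝ) * A := by
  have hf_int : Integrable f :=
    integrable_of_normHdot01_ne_top (hf.trans_lt ENNReal.ofReal_lt_top).ne
  have htoReal : ∀ {z : ℂ} {r : ℝ}, 0 < r →
      ‖z‖ₑ ≤ ENNReal.ofReal (3 * √Real.pi * r ^ (-1 / 4 : ℝ)) * normHdot01 f →
      ‖z‖ ≤ 3 * √Real.pi * r ^ (-1 / 4 : ℝ) * A := by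
    intro z r hr hz
    refine toReal_enorm z ▸ ENNReal.toReal_le_of_le_ofReal (by positivity) (hz.trans ?_)
    rw [ENNReal.ofReal_mul (p := 3 * √Real.pi * r ^ (-1 / 4 : ℝ)) (by positivity)]
    gcongr
  have hcutoff := htoReal (hs.trans_le hst) (enorm_cutoffFourier_sub_le (hs.trans_le hst) hf_int k)
  have hchirp := htoReal hs (enorm_chirpFourier_sub_fourier_le hs hf_int k)
  have hpow : t ^ (-1 / 4 : ℝ) ≤ s ^ (-1 / 4 : ℝ) :=
    Real.rpow_le_rpow_of_nonpos hs hst (by norm_num)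
  calc ‖cutoffFourier t k f - chirpFourier s f k‖
      ≤ ‖cutoffFourier t k f - 𝓕 (f : ℝ → ℂ) k‖ + ‖chirpFourier s f k - 𝓕 (f : ℝ → ℂ) k‖ := by
        rw [← sub_sub_sub_cancel_right _ _ (𝓕 (f : ℝ → ℂ) k)]
        exact norm_sub_le _ _
    _ ≤ 3 * √Real.pi * s ^ (-1 / 4 : ℝ) * A + 3 * √Real.pi * s ^ (-1 / 4 : ℝ) * A :=
        add_le_add (hcutoff.trans (by gcongr)) hchirp
    _ = 6 * √Real.pi * s ^ (-1 / 4 : ℝ) * A := by ring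

theorem exists_norm_cutoffFourier_cubic_sub_le {v : L2} {s t A M : ℝ} (hs : 0 < s) (hst : s ≤ t)
    (hA : 0 ≤ A) (hv : Integrable v) (hM : ∀ᵐ x, ‖v x‖ ≤ M)
    (hf : normHdot01 (freeGroup (-s) v) ≤ ENNReal.ofReal A) (k : ℝ) :
    ∃ r : ℝ, ‖cutoffFourier t k (freeGroup (-s) (cubic v)) -
      (r : ℂ) • cutoffFourier t k (freeGroup (-s) v)‖ ≤
        24 * √Real.pi * M ^ 2 * s ^ (-1 / 4 : ℝ) * A := by
  set f := freeGroup (-s) v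
  set g := freeGroup (-s) (cubic v)
  have hg : normHdot01 g ≤ ENNReal.ofReal (3 * M ^ 2 * A) := by
    rw [ENNReal.ofReal_mul (by positivity)]
    exact (normHdot01_freeGroup_cubic_le (neg_ne_zero.2 hs.ne') hv hM).trans (by gcongr)
  have hf_int : Integrable f :=
    integrable_of_normHdot01_ne_top (hf.trans_lt ENNReal.ofReal_lt_top).ne
  have hg_int : Integrable g :=
    integrable_of_normHdot01_ne_top (hg.trans_lt ENNReal.ofReal_lt_top).ne
  set r := ‖chirpFourier s f k‖ ^ 2 / (2 * Real.pi * s)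
  have hr_nonneg : 0 ≤ r := by positivity
  have hr_le : r ≤ M ^ 2 := by
    rw [div_le_iff₀' (by positivity), ← Real.sq_sqrt (by positivity : 0 ≤ 2 * Real.pi * s),
      ← mul_pow]
    exact pow_le_pow_left₀ (norm_nonneg _) (norm_chirpFourier_le hs hf_int hM k) 2
  have herror_f := norm_cutoffFourier_sub_chirpFourier_le hs hst hA hf k
  have herror_g := norm_cutoffFourier_sub_chirpFourier_le hs hst (by positivity) hg k
  have hsplit : cutoffFourier t k g - (r : ℂ) • cutoffFourier t k f =
      (cutoffFourier t k g - chirpFourier s g k) -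
        (r : ℂ) * (cutoffFourier t k f - chirpFourier s f k) := by
    rw [chirpFourier_cubic hs hf_int hM hg_int, smul_eq_mul]
    ring
  refine ⟨r, ?_⟩
  calc ‖cutoffFourier t k g - (r : ℂ) • cutoffFourier t k f‖
      ≤ ‖cutoffFourier t k g - chirpFourier s g k‖ +
          r * ‖cutoffFourier t k f - chirpFourier s f k‖ := by
        rw [hsplit]
        refine (norm_sub_le _ _).trans_eq ?_
        rw [norm_mul, Complex.norm_of_nonneg hr_nonneg]
    _ ≤ 6 * √Real.pi * s ^ (-1 / 4 : ℝ) * (3 * M ^ 2 * A) +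
          M ^ 2 * (6 * √Real.pi * s ^ (-1 / 4 : ℝ) * A) := by gcongr
    _ = 24 * √Real.pi * M ^ 2 * s ^ (-1 / 4 : ℝ) * A := by ring

theorem integral_rpow_le {β t : ℝ} (hβ : β < -1) (ht : 1 ≤ t) :
    ∫ s in (1 : ℝ)..t, s ^ β ≤ 1 / (-1 - β) := by
  have hzero : (0 : ℝ) ∉ uIcc 1 t := notMem_uIcc_of_lt one_pos (one_pos.trans_le ht)
  calc ∫ s in (1 : ℝ)..t, s ^ β = (1 - t ^ (β + 1)) / (-1 - β) := by
        rw [integral_rpow (Or.inr ⟨hβ.ne, hzero⟩), Real.one_rpow, ← neg_div_neg_eq, neg_sub,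
          neg_add_rev, ← sub_eq_add_neg]
    _ ≤ 1 / (-1 - β) :=
        div_le_div_of_nonneg_right (sub_le_self _ (Real.rpow_nonneg (zero_le_one.trans ht) _))
          (by linarith)

variable {α T t x ε : ℝ} {uStar : L2} {u : ℝ → L2}

theorem IsSolution.cutoffFourier_profile_eq (hu : IsSolution T uStar u) (ht : t ∈ Icc 1 T)
    (r k : ℝ) :
    cutoffFourier r k (profile u t) = cutoffFourier r k uStar -
      Complex.I • ∫ s in (1 : ℝ)..t, cutoffFourier r k (pulledCubic u s) := by
  have hint : IntervalIntegrable (pulledCubic u) volume 1 t := by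
    refine ContinuousOn.intervalIntegrable ?_
    rw [uIcc_of_le ht.1]
    exact hu.continuous.continuousOn_pulledCubic ht.2
  rw [hu.profile_eq ht, map_sub, map_smul, (cutoffFourier r k).intervalIntegral_comp_comm hint]

/-- The left-hand side is the growth rate of `½ ‖cutoffFourier t k (profile u s)‖²`. -/
theorem ae_inner_cutoffFourier_pulledCubic_le (hu : ContinuousIntoH T u) (hx : 0 ≤ x)
    (hX : normX α T u ≤ ENNReal.ofReal x) (ht : t ≤ T) (k : ℝ) :
    ∀ᵐ s ∂volume.restrict (Icc 1 t),
      (inner ℂ (cutoffFourier t k (profile u s)) (cutoffFourier t k (pulledCubic u s))).im ≤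
        ‖cutoffFourier t k (profile u s)‖ * (24 * √Real.pi * x ^ 3 * s ^ (α - 5 / 4)) := by
  filter_upwards [ae_mono (Measure.restrict_mono (Icc_subset_Icc_right ht) le_rfl)
    (ae_bounds_of_normX_le hx hX), ae_restrict_mem measurableSet_Icc] with s ⟨hsup, _, hdot01⟩ hs
  have hs_pos : 0 < s := one_pos.trans_le hs.1
  obtain ⟨r, hr⟩ := exists_norm_cutoffFourier_cubic_sub_le hs_pos hs.2 (by positivity)
    (hu.integrable ⟨hs.1, hs.2.trans ht⟩) hsup hdot01 k
  have hrate : s ^ (α - 5 / 4) = s ^ (-1 : ℝ) * s ^ (-1 / 4 : ℝ) * s ^ α := by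
    rw [← Real.rpow_add hs_pos, ← Real.rpow_add hs_pos]
    ring_nf
  refine inner_im_le_of_norm_sub_smul_le (r := r) (hr.trans_eq ?_)
  rw [mul_rpow_neg_half_sq hs_pos.le, hrate]
  ring

theorem IsSolution.norm_cutoffFourier_profile_le (hu : IsSolution T uStar u) (hα : α < 1 / 4)
    (hx : 0 ≤ x) (hX : normX α T u ≤ ENNReal.ofReal x) (ht : t ∈ Icc 1 T) (k : ℝ) :
    ‖cutoffFourier t k (profile u t)‖ ≤
      ‖cutoffFourier t k uStar‖ + 24 * √Real.pi * x ^ 3 / (1 / 4 - α) := by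
  have hint : IntervalIntegrable (fun s : ℝ => 24 * √Real.pi * x ^ 3 * s ^ (α - 5 / 4))
      volume 1 t :=
    (intervalIntegral.intervalIntegrable_rpow
      (Or.inr (notMem_uIcc_of_lt one_pos (one_pos.trans_le ht.1)))).const_mul _
  have hnonneg : ∀ᵐ s ∂volume.restrict (Icc 1 t),
      0 ≤ 24 * √Real.pi * x ^ 3 * s ^ (α - 5 / 4) :=
    ae_restrict_of_forall_mem measurableSet_Icc fun s hs =>
      mul_nonneg (by positivity) (Real.rpow_nonneg (zero_le_one.trans hs.1) _)
  have hrate : ∫ s in (1 : ℝ)..t, s ^ (α - 5 / 4) ≤ 1 / (1 / 4 - α) :=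
    (integral_rpow_le (by linarith) ht.1).trans_eq (by ring_nf)
  calc ‖cutoffFourier t k (profile u t)‖
      ≤ ‖cutoffFourier t k uStar‖ +
          ∫ s in (1 : ℝ)..t, 24 * √Real.pi * x ^ 3 * s ^ (α - 5 / 4) :=
        norm_le_add_integral_of_duhamel ht.1
          ((cutoffFourier t k).continuous.comp_continuousOn
            (hu.continuous.continuousOn_pulledCubic ht.2))
          (fun τ hτ => hu.cutoffFourier_profile_eq ⟨hτ.1, hτ.2.trans ht.2⟩ t k) hint
          (hnonneg.and (ae_inner_cutoffFourier_pulledCubic_le hu.continuous hx hX ht.2 k))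
    _ ≤ ‖cutoffFourier t k uStar‖ + 24 * √Real.pi * x ^ 3 / (1 / 4 - α) := by
        rw [intervalIntegral.integral_const_mul, ← mul_one_div _ (1 / 4 - α)]
        gcongr

theorem IsSolution.norm_chirpFourier_profile_le (hu : IsSolution T uStar u) (hα : 0 < α)
    (hα_lt : α < 1 / 4) (hx : 0 ≤ x) (hε : 0 ≤ ε) (hX : normX α T u ≤ ENNReal.ofReal x)
    (hstar : normH01 uStar ≤ ENNReal.ofReal ε) (ht : t ∈ Icc 1 T) (k : ℝ) :
    ‖chirpFourier t (profile u t) k‖ ≤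
      √Real.pi * (7 * ε + (24 / (1 / 4 - α) + 18 / α) * x ^ 3) := by
  have ht_pos : 0 < t := one_pos.trans_le ht.1
  have htransfer := norm_cutoffFourier_sub_chirpFourier_le ht_pos le_rfl (by positivity)
    (hu.normHdot01_profile_le hα hx hε hX ((normHdot01_le_normH01 _).trans hstar) ht) k
  have hpow : t ^ (-1 / 4 : ℝ) * t ^ α ≤ 1 := by
    rw [← Real.rpow_add ht_pos]
    exact Real.rpow_le_one_of_one_le_of_nonpos ht.1 (by linarith)
  calc ‖chirpFourier t (profile u t) k‖
      ≤ ‖cutoffFourier t k (profile u t)‖ +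
          ‖cutoffFourier t k (profile u t) - chirpFourier t (profile u t) k‖ :=
        norm_le_norm_add_norm_sub _ _
    _ ≤ (√Real.pi * ε + 24 * √Real.pi * x ^ 3 / (1 / 4 - α)) +
          6 * √Real.pi * t ^ (-1 / 4 : ℝ) * ((ε + 3 * x ^ 3 / α) * t ^ α) := by
        gcongr
        refine (hu.norm_cutoffFourier_profile_le hα_lt hx hX ht k).trans ?_
        gcongr
        exact norm_le_of_enorm_le_eLpNorm_one hε hstar (enorm_cutoffFourier_le t k uStar)
    _ = (√Real.pi * ε + 24 * √Real.pi * x ^ 3 / (1 / 4 - α)) +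
          6 * √Real.pi * (ε + 3 * x ^ 3 / α) * (t ^ (-1 / 4 : ℝ) * t ^ α) := by ring
    _ ≤ (√Real.pi * ε + 24 * √Real.pi * x ^ 3 / (1 / 4 - α)) +
          6 * √Real.pi * (ε + 3 * x ^ 3 / α) * 1 := by gcongr
    _ = √Real.pi * (7 * ε + (24 / (1 / 4 - α) + 18 / α) * x ^ 3) := by ring

theorem IsSolution.eLpNorm_top_le (hu : IsSolution T uStar u) (hα : 0 < α)
    (hα_lt : α < 1 / 4) (hx : 0 ≤ x) (hε : 0 ≤ ε) (hX : normX α T u ≤ ENNReal.ofReal x)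
    (hstar : normH01 uStar ≤ ENNReal.ofReal ε) (ht : t ∈ Icc 1 T) :
    eLpNorm (u t) ∞ volume ≤
      ENNReal.ofReal ((7 * ε + (24 / (1 / 4 - α) + 18 / α) * x ^ 3) * t ^ (-(1 / 2) : ℝ)) :=
  eLpNorm_top_le_ofReal (ae_norm_le_of_chirpFourier (one_pos.trans_le ht.1)
    (hu.continuous.integrable_profile ht)
    (hu.norm_chirpFourier_profile_le hα hα_lt hx hε hX hstar ht))

theorem IsSolution.normX_le (hu : IsSolution T uStar u) (hα : 0 < α) (hα_lt : α < 1 / 4)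
    (hx : 0 ≤ x) (hε : 0 ≤ ε) (hX : normX α T u ≤ ENNReal.ofReal x)
    (hstar : normH10 uStar + normH01 uStar ≤ ENNReal.ofReal ε) :
    normX α T u ≤ ENNReal.ofReal (10 * ε + (24 / (1 / 4 - α) + 24 / α) * x ^ 3) := by
  have hstar10 : normH10 uStar ≤ ENNReal.ofReal ε := le_self_add.trans hstar
  have hstar01 : normH01 uStar ≤ ENNReal.ofReal ε := le_add_self.trans hstar
  have hα_sub : 0 < 1 / 4 - α := sub_pos.2 hα_lt
  have hsup := supTime_rpow_mul_le fun t ht =>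
    hu.eLpNorm_top_le hα hα_lt hx hε hX hstar01 (t := t) ht
  have hdot10 : supTime T (fun t => ENNReal.ofReal (t ^ (-α)) * normHdot10 (u t)) ≤
      ENNReal.ofReal (ε + 3 * x ^ 3 / α) := by
    refine supTime_rpow_mul_le fun t ht => ?_
    rw [neg_neg]
    exact hu.normHdot10_le hα hx hε hX ((normHdot10_le_normH10 _).trans hstar10) ht
  have hdot01 : supTime T (fun t => ENNReal.ofReal (t ^ (-α)) * normHdot01 (profile u t)) ≤
      ENNReal.ofReal (ε + 3 * x ^ 3 / α) := by
    refine supTime_rpow_mul_le fun t ht => ?_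
    rw [neg_neg]
    exact hu.normHdot01_profile_le hα hx hε hX ((normHdot01_le_normH01 _).trans hstar01) ht
  have hmass : supTime T (fun t => eLpNorm (u t) 2 volume) ≤ ENNReal.ofReal ε := by
    refine supTime_le fun t ht => ?_
    rw [← Lp.enorm_def]
    exact (enorm_le_iff_norm_le.2 (hu.norm_le ht)).trans ((enorm_le_normH01 _).trans hstar01)
  calc normX α T u
      ≤ ENNReal.ofReal (7 * ε + (24 / (1 / 4 - α) + 18 / α) * x ^ 3) +
          ENNReal.ofReal (ε + 3 * x ^ 3 / α) + ENNReal.ofReal (ε + 3 * x ^ 3 / α) +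
          ENNReal.ofReal ε :=
        add_le_add (add_le_add (add_le_add hsup hdot10) hdot01) hmass
    _ = ENNReal.ofReal (10 * ε + (24 / (1 / 4 - α) + 24 / α) * x ^ 3) := by
        rw [← ENNReal.ofReal_add (by positivity) (by positivity),
          ← ENNReal.ofReal_add (by positivity) (by positivity),
          ← ENNReal.ofReal_add (by positivity) hε]
        ring_nf

end DispersiveDecay

end NLS

end

theorem proposition1p3 :
    ∃ (C₀ : ℝ≥0) (α₀ : ℝ), 0 < α₀ ∧ ∀ α : ℝ, 0 < α → α < α₀ →
      ∃ C : ℝ≥0, ∀ (ε : ℝ≥0) (T : ℝ) (uStar : NLS.L2) (u : ℝ → NLS.L2),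
        1 < T →
        NLS.normH10 uStar + NLS.normH01 uStar ≤ ε →
        NLS.IsSolution T uStar u →
        NLS.normX α T u < ∞ ∧
        NLS.normX α T u ≤ C₀ * ε + C * NLS.normX α T u ^ 3 := by
  refine ⟨10, 1 / 4, by norm_num, fun α hα hα_lt =>
    ⟨(24 / (1 / 4 - α) + 24 / α).toNNReal, fun ε T uStar u _ hstar hu => ?_⟩⟩
  have hfinite : NLS.normX α T u < ∞ := NLS.normX_lt_top α hu.continuous
  refine ⟨hfinite, ?_⟩
  obtain ⟨x, hx⟩ : ∃ x : ℝ≥0, NLS.normX α T u = x := ⟨_, (ENNReal.coe_toNNReal hfinite.ne).symm⟩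
  have hC : 0 ≤ 24 / (1 / 4 - α) + 24 / α :=
    add_nonneg (div_nonneg (by norm_num) (sub_pos.2 hα_lt).le) (by positivity)
  calc NLS.normX α T u
      ≤ ENNReal.ofReal (10 * ε + (24 / (1 / 4 - α) + 24 / α) * x ^ 3) :=
        hu.normX_le hα hα_lt x.2 ε.2 (hx.trans_le ENNReal.ofReal_coe_nnreal.ge)
          (hstar.trans_eq ENNReal.ofReal_coe_nnreal.symm)
    _ = (10 : ℝ≥0) * ε + ((24 / (1 / 4 - α) + 24 / α).toNNReal : ℝ≥0) * NLS.normX α T u ^ 3 := by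
        rw [hx, ENNReal.ofReal_add (by positivity) (by positivity), ENNReal.ofReal_mul hC,
          ENNReal.ofReal_mul (by norm_num), ENNReal.ofReal_pow x.coe_nonneg,
          ENNReal.ofReal_coe_nnreal, ENNReal.ofReal_coe_nnreal, ENNReal.ofReal_ofNat]
        rfl
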